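/- **Notation.** Let $G=GL_2^+(\mathbb Q)$ and, for $\alpha=\begin{pmatrix}a&b\\c&d\end{pmatrix}\in G$ and $f$ of weight $k$, put $(f|_k\alpha)(z)=\det(\alpha)^{k/2}(cz+d)^{-k}f(\alpha z)$. Let $\mathcal M=\bigoplus_{k}\mathcal M_k$ be the graded algebra of modular forms of all levels ($\mathcal M_k$ is the union over $N\ge1$ of the spaces of holomorphic modular forms of weight $k$ for $\Gamma(N)$; weight $0$, i.e. the constants, is included), on which $G$ acts from the right by $|$ in each weight, and let $\mathcal M^0\subset\mathcal M$ be the ideal of cusp forms. For a congruence subgroup $\Gamma\subset SL_2(\mathbb Z)$ the modular Hecke algebra $\mathcal A(\Gamma)$ consists of the maps $F:\Gamma\backslash G\to\mathcal M$, $\Gamma\alpha\mapsto F_\alpha$, of finite support with $F_{\alpha\gamma}=F_\alpha|\gamma$ for $\gamma\in\Gamma$, with product $$(F^1*F^2)_\alpha=\sum_{\beta\in\Gamma\backslash G}F^1_\beta\cdot\bigl(F^2_{\alpha\beta^{-1}}|\beta\bigr).$$ The algebra $\mathcal M(\Gamma)$ of modular forms for $\Gamma$ is embedded in $\mathcal A(\Gamma)$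 by sending $f$ to the map with value $f$ on $\Gamma$ and $0$ elsewhere. The cuspidal ideal is $\mathcal A^0(\Gamma)=\{F:\ F_\alpha\in\mathcal M^0\ \text{for all }\alpha\}$. Let $\mathcal H_1$ be the Connes–Moscovici Hopf algebra over $\mathbb C$: as an algebra it is generated by $X,Y,\delta_n$ ($n\ge1$) with $[Y,X]=X$, $[Y,\delta_n]=n\delta_n$, $[X,\delta_n]=\delta_{n+1}$, $[\delta_k,\delta_l]=0$, and its coproduct is determined by $\Delta Y=Y\otimes1+1\otimes Y$, $\Delta\delta_1=\delta_1\otimes1+1\otimes\delta_1$, $\Delta X=X\otimes1+1\otimes X+\delta_1\otimes Y$, with counit vanishing on the generators. A Hopf action on an algebra $A$ is an $\mathcal H_1$-module structure with $h(ab)=\sum h_{(1)}(a)h_{(2)}(b)$ and $h(1)=\varepsilon(h)1$. Let $\nu$ be the character with $\nu(Y)=1$, $\nu(X)=\nu(\delta_n)=0$, and let $HC^2_{\rm Hopf}(\mathcal H_1)$ be the Hopf cyclic cohomology of $(\mathcal H_1,\nu)$, computed by the normalized $(b,B)$-bicomplex. On $f$ of weight $k$ let $Y(f)=\frac k2f$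 and $$X(f)=\frac1{2\pi i}\frac{df}{dz}-\frac1{12\pi i}\frac{d\log\Delta}{dz}\,Y(f),\qquad \mu_\alpha=\frac1{12\pi i}\frac{d}{dz}\log\frac{\Delta|_{12}\alpha}{\Delta}\quad(\alpha\in G),$$ where $\Delta=\eta^{24}$ ($\mu_\alpha$ is of weight $2$ and $X$ raises the weight by $2$). Let $\omega_4=-\frac1{72}E_4$, and for $f,g$ of weights $k,l$ let $\{f,g\}_1=X(f)Y(g)-Y(f)X(g)=\frac1{2\pi i}\bigl(\frac l2f'g-\frac k2fg'\bigr)$ be the first Rankin–Cohen bracket, extended bilinearly to $\mathcal M$. **Theorem.** Let $\Gamma$ be any congruence subgroup of $SL_2(\mathbb Z)$. 1. The formulas $Y(F)_\alpha=Y(F_\alpha)$, $X(F)_\alpha=X(F_\alpha)$, $\delta_n(F)_\alpha=X^{n-1}(\mu_\alpha)\cdot F_\alpha$ ($n\ge1$) define a Hopf action of $\mathcal H_1$ on $\mathcal A(\Gamma)$. 2. The Schwarzian derivation $\delta_2'=\delta_2-\frac12\delta_1^2$ is inner, implemented by $\omega_4\in\mathcal M_4(\Gamma)\subset\mathcal A(\Gamma)$: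 $\delta_2'(a)=a\,\omega_4-\omega_4\,a$ for all $a\in\mathcal A(\Gamma)$. Moreover $\omega_4=(2\pi i)^{-2}\{Z;z\}$ for every primitive $Z$ on the upper half-plane, $dZ=\frac{2\pi i}6\eta^4dz$, where $\{y;z\}=(\log y')''-\frac12((\log y')')^2$. 3. $F=X\otimes Y-Y\otimes X-\delta_1Y\otimes Y$ is a Hopf cyclic $2$-cocycle, and the image of its class $[F]\in HC^2_{\rm Hopf}(\mathcal H_1)$ under the canonical map to the Hochschild cohomology $HH^2(\mathcal A(\Gamma),\mathcal A(\Gamma))$ is the class of the Hochschild cocycle $$\chi(F)(a_1,a_2)=X(a_1)Y(a_2)-Y(a_1)X(a_2)-\delta_1(Y(a_1))Y(a_2).$$ This cocycle is the natural extension of the first Rankin–Cohen bracket to $\mathcal A(\Gamma)$: for $f\in\mathcal M_k(\Gamma)$, $g\in\mathcal M_l(\Gamma)$ one has $\{f,g\}_1\in\mathcal M_{k+l+2}(\Gamma)$ and $\chi(F)(f,g)=\{f,g\}_1$, and for all $a_1,a_2\in\mathcal A(\Gamma)$ and $\alpha\in G$ $$\chi(F)(a_1,a_2)_\alpha=\sum_{\beta\in\Gamma\backslash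 G}\bigl\{(a_1)_\beta,\ (a_2)_{\alpha\beta^{-1}}|\beta\bigr\}_1 .$$ 4. The cuspidal ideal is invariant: $h(\mathcal A^0(\Gamma))\subset\mathcal A^0(\Gamma)$ for all $h\in\mathcal H_1$. -/

import Mathlib

noncomputable section

open scoped TensorProduct

namespace ConnesMoscovici

/-- Generators of the Hopf algebra `H₁`; `δ n` is `δ_n`, for `n ≥ 1`. -/
inductive Gen
  | X : Gen
  | Y : Gen
  | δ : ℕ+ → Gen

open FreeAlgebra in
/-- The relations `[Y, X] = X`, `[Y, δ_n] = n δ_n`, `[X, δ_n] = δ_{n+1}`, `[δ_k, δ_l] = 0`. -/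
inductive Rel : FreeAlgebra ℂ Gen → FreeAlgebra ℂ Gen → Prop
  | yx : Rel (ι ℂ Gen.Y * ι ℂ Gen.X - ι ℂ Gen.X * ι ℂ Gen.Y) (ι ℂ Gen.X)
  | yδ (n : ℕ+) : Rel (ι ℂ Gen.Y * ι ℂ (Gen.δ n) - ι ℂ (Gen.δ n) * ι ℂ Gen.Y)
      (((n : ℕ) : ℂ) • ι ℂ (Gen.δ n))
  | xδ (n : ℕ+) : Rel (ι ℂ Gen.X * ι ℂ (Gen.δ n) - ι ℂ (Gen.δ n) * ι ℂ Gen.X)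
      (ι ℂ (Gen.δ (n + 1)))
  | δδ (k l : ℕ+) : Rel (ι ℂ (Gen.δ k) * ι ℂ (Gen.δ l) - ι ℂ (Gen.δ l) * ι ℂ (Gen.δ k)) 0

/-- The algebra `H₁`: the enveloping algebra of the Lie algebra presented by `X`, `Y`, `δ_n`
with the above brackets. -/
def H1 : Type := RingQuot Rel

instance : Ring H1 := inferInstanceAs (Ring (RingQuot Rel))

instance : Algebra ℂ H1 := inferInstanceAs (Algebra ℂ (RingQuot Rel))

namespace H1

/-- The quotient map from the free algebra. -/
def mk : FreeAlgebra ℂ Gen →ₐ[ℂ] H1 := RingQuot.mkAlgHom ℂ Rel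

/-- The generator `X`. -/
def X : H1 := mk (FreeAlgebra.ι ℂ Gen.X)

/-- The generator `Y`. -/
def Y : H1 := mk (FreeAlgebra.ι ℂ Gen.Y)

/-- The generator `δ_n`, `n ≥ 1`. -/
def δ (n : ℕ+) : H1 := mk (FreeAlgebra.ι ℂ (Gen.δ n))

theorem mk_rel {a b : FreeAlgebra ℂ Gen} (h : Rel a b) : mk a = mk b :=
  RingQuot.mkAlgHom_rel ℂ h

theorem yx : Y * X - X * Y = X := by
  simpa using! mk_rel Rel.yx

theorem yδ (n : ℕ+) : Y * δ n - δ n * Y = ((n : ℕ) : ℂ) • δ n := by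
  simpa using! mk_rel (Rel.yδ n)

theorem yx' : Y * X = X + X * Y := sub_eq_iff_eq_add.1 yx

theorem yδ' : Y * δ 1 = δ 1 + δ 1 * Y := sub_eq_iff_eq_add.1 (by simpa using yδ 1)

theorem xδ (n : ℕ+) : X * δ n - δ n * X = δ (n + 1) := by
  simpa using! mk_rel (Rel.xδ n)

theorem δδ (k l : ℕ+) : δ k * δ l = δ l * δ k :=
  sub_eq_zero.1 (by simpa using! mk_rel (Rel.δδ k l))

theorem induction {P : H1 → Prop} (hc : ∀ c : ℂ, P (algebraMap ℂ H1 c)) (hX : P X) (hY : P Y)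
    (hδ : P (δ 1)) (hadd : ∀ a b, P a → P b → P (a + b)) (hmul : ∀ a b, P a → P b → P (a * b))
    (h : H1) : P h := by
  obtain ⟨a, rfl⟩ : ∃ a, mk a = h := RingQuot.mkAlgHom_surjective ℂ Rel h
  have hneg : ∀ a, P a → P (-a) := fun a ha ↦ by
    have := hmul _ _ (hc (-1)) ha
    simpa using this
  have hδn : ∀ n, P (δ n) := fun n ↦ by
    induction n using PNat.recOn with
    | one => exact hδ
    | succ n ih =>
      rw [← xδ, sub_eq_add_neg]
      exact hadd _ _ (hmul _ _ hX ih) (hneg _ (hmul _ _ ih hX))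
  induction a using FreeAlgebra.induction with
  | grade0 c => rw [AlgHom.commutes]; exact hc c
  | grade1 g =>
    cases g with
    | X => exact hX
    | Y => exact hY
    | δ n => exact hδn n
  | mul a b ha hb => rw [map_mul]; exact hmul _ _ ha hb
  | add a b ha hb => rw [map_add]; exact hadd _ _ ha hb

theorem algHom_ext {B : Type*} [Ring B] [Algebra ℂ B] {f g : H1 →ₐ[ℂ] B} (hX : f X = g X)
    (hY : f Y = g Y) (hδ : f (δ 1) = g (δ 1)) : f = g := by
  ext h
  induction h using induction with
  | hc c => simp
  | hX => exact hX
  | hY => exact hY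
  | hδ => exact hδ
  | hadd a b ha hb => simp [ha, hb]
  | hmul a b ha hb => simp [ha, hb]

section Lift

variable {B : Type*} [Ring B]

/-- The elements `d, [x, d], [x, [x, d]], …`. -/
def adIter (x d : B) (n : ℕ+) : B := (fun t ↦ x * t - t * x)^[n.natPred] d

theorem adIter_one (x d : B) : adIter x d 1 = d := rfl

theorem adIter_succ (x d : B) (n : ℕ+) :
    adIter x d (n + 1) = x * adIter x d n - adIter x d n * x := by
  have : (n + 1).natPred = n.natPred + 1 := by
    have := n.natPred_add_one
    have := (n + 1).natPred_add_one
    rw [PNat.add_coe] at this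
    simp only [PNat.one_coe] at this
    omega
  rw [adIter, this, Function.iterate_succ_apply']
  rfl

variable [Algebra ℂ B]

theorem ad_mem_adjoin {s : Set B} {x : B} (hx : ∀ t ∈ s, x * t - t * x ∈ Algebra.adjoin ℂ s)
    {t : B} (ht : t ∈ Algebra.adjoin ℂ s) : x * t - t * x ∈ Algebra.adjoin ℂ s := by
  induction ht using Algebra.adjoin_induction with
  | mem t ht => exact hx t ht
  | algebraMap r => rw [Algebra.commutes, sub_self]; exact zero_mem _
  | add a b _ _ ha hb =>
    rw [show x * (a + b) - (a + b) * x = (x * a - a * x) + (x * b - b * x) by noncomm_ring]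
    exact add_mem ha hb
  | mul a b ha' hb' ha hb =>
    rw [show x * (a * b) - a * b * x = (x * a - a * x) * b + a * (x * b - b * x) by noncomm_ring]
    exact add_mem (mul_mem ha hb') (mul_mem ha' hb)

theorem adIter_mem {s : Set B} {x d : B}
    (hx : ∀ t ∈ s, x * t - t * x ∈ Algebra.adjoin ℂ s) (hd : d ∈ Algebra.adjoin ℂ s) (n : ℕ+) :
    adIter x d n ∈ Algebra.adjoin ℂ s := by
  induction n using PNat.recOn with
  | one => exact hd
  | succ n ih => rw [adIter_succ]; exact ad_mem_adjoin hx ih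

theorem y_adIter {x y d : B} (hyx : y * x - x * y = x) (hyd : y * d - d * y = d) (n : ℕ+) :
    y * adIter x d n - adIter x d n * y = ((n : ℕ) : ℂ) • adIter x d n := by
  induction n using PNat.recOn with
  | one => simpa [adIter_one] using hyd
  | succ n ih =>
    rw [adIter_succ]
    generalize adIter x d n = t at ih
    have e1 : y * x = x + x * y := sub_eq_iff_eq_add.1 hyx
    have e2 : y * t = ((n : ℕ) : ℂ) • t + t * y := sub_eq_iff_eq_add.1 ih
    have e3 : y * (x * t) = x * t + ((n : ℕ) : ℂ) • (x * t) + x * t * y := by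
      rw [← mul_assoc, e1, add_mul, mul_assoc, e2, mul_add, mul_smul_comm]
      noncomm_ring
    have e4 : y * (t * x) = t * x + ((n : ℕ) : ℂ) • (t * x) + t * x * y := by
      rw [← mul_assoc, e2, add_mul, mul_assoc t y x, e1, mul_add, smul_mul_assoc]
      noncomm_ring
    rw [mul_sub, sub_mul, e3, e4]
    push_cast
    rw [add_smul, one_smul, smul_sub]
    abel

/-- The algebra homomorphism out of `H₁` with given values on `X`, `Y`, `δ_1`. -/
def lift (x y d : B) (s : Set B) (hs : ∀ a ∈ s, ∀ b ∈ s, a * b = b * a) (hd : d ∈ Algebra.adjoin ℂ s)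
    (hx : ∀ t ∈ s, x * t - t * x ∈ Algebra.adjoin ℂ s) (hyx : y * x - x * y = x)
    (hyd : y * d - d * y = d) : H1 →ₐ[ℂ] B :=
  RingQuot.liftAlgHom ℂ ⟨FreeAlgebra.lift ℂ fun g : Gen ↦ match g with
    | Gen.X => x
    | Gen.Y => y
    | Gen.δ n => adIter x d n, by
    intro a b h
    cases h with
    | yx => simpa using hyx
    | yδ n => simpa using y_adIter hyx hyd n
    | xδ n => simpa using (adIter_succ x d n).symm
    | δδ k l =>
      simp only [map_sub, map_mul, FreeAlgebra.lift_ι_apply, map_zero, sub_eq_zero]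
      have := Algebra.isMulCommutative_adjoin ℂ hs
      exact congrArg Subtype.val (mul_comm' (⟨_, adIter_mem hx hd k⟩ : Algebra.adjoin ℂ s)
        ⟨_, adIter_mem hx hd l⟩)⟩

variable (x y d : B) (s : Set B) (hs : ∀ a ∈ s, ∀ b ∈ s, a * b = b * a) (hd : d ∈ Algebra.adjoin ℂ s)
    (hx : ∀ t ∈ s, x * t - t * x ∈ Algebra.adjoin ℂ s) (hyx : y * x - x * y = x)
    (hyd : y * d - d * y = d)

theorem lift_X : lift x y d s hs hd hx hyx hyd X = x := by
  unfold lift X mk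
  exact (RingQuot.liftAlgHom_mkAlgHom_apply ..).trans (by simp)

theorem lift_Y : lift x y d s hs hd hx hyx hyd Y = y := by
  unfold lift Y mk
  exact (RingQuot.liftAlgHom_mkAlgHom_apply ..).trans (by simp)

theorem lift_δ : lift x y d s hs hd hx hyx hyd (δ 1) = d := by
  unfold lift δ mk
  exact (RingQuot.liftAlgHom_mkAlgHom_apply ..).trans (by simp [adIter_one])

end Lift

/-- The coproduct. -/
def comulHom : H1 →ₐ[ℂ] H1 ⊗[ℂ] H1 :=
  lift (X ⊗ₜ 1 + 1 ⊗ₜ X + δ 1 ⊗ₜ Y) (Y ⊗ₜ 1 + 1 ⊗ₜ Y) (δ 1 ⊗ₜ 1 + 1 ⊗ₜ δ 1)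
    (Set.range (fun n ↦ δ n ⊗ₜ[ℂ] (1 : H1)) ∪ Set.range (fun n ↦ (1 : H1) ⊗ₜ[ℂ] δ n))
    (by
      rintro a (⟨n, rfl⟩ | ⟨n, rfl⟩) b (⟨m, rfl⟩ | ⟨m, rfl⟩) <;> simp [δδ m n])
    (add_mem (Algebra.subset_adjoin (Or.inl ⟨1, rfl⟩)) (Algebra.subset_adjoin (Or.inr ⟨1, rfl⟩)))
    (by
      have hA (n : ℕ+) : δ n ⊗ₜ[ℂ] (1 : H1) ∈ Algebra.adjoin ℂ
          (Set.range (fun n ↦ δ n ⊗ₜ[ℂ] (1 : H1)) ∪ Set.range (fun n ↦ (1 : H1) ⊗ₜ[ℂ] δ n)) :=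
        Algebra.subset_adjoin (Or.inl ⟨n, rfl⟩)
      have hB (n : ℕ+) : (1 : H1) ⊗ₜ[ℂ] δ n ∈ Algebra.adjoin ℂ
          (Set.range (fun n ↦ δ n ⊗ₜ[ℂ] (1 : H1)) ∪ Set.range (fun n ↦ (1 : H1) ⊗ₜ[ℂ] δ n)) :=
        Algebra.subset_adjoin (Or.inr ⟨n, rfl⟩)
      rintro t (⟨n, rfl⟩ | ⟨n, rfl⟩)
      · convert hA (n + 1) using 1
        simp [mul_add, add_mul, ← xδ, TensorProduct.sub_tmul, δδ 1 n]
      · convert add_mem (hB (n + 1))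
          (Subalgebra.smul_mem _ (mul_mem (hA 1) (hB n)) ((n : ℕ) : ℂ)) using 1
        rw [Algebra.TensorProduct.tmul_mul_tmul, mul_one, one_mul, ← TensorProduct.tmul_smul,
          ← yδ, ← xδ, TensorProduct.tmul_sub, TensorProduct.tmul_sub]
        simp only [mul_add, add_mul, Algebra.TensorProduct.tmul_mul_tmul, mul_one, one_mul]
        abel)
    (by
      simp [mul_add, add_mul, TensorProduct.add_tmul, TensorProduct.tmul_add, yx', yδ']
      abel)
    (by
      simp [mul_add, add_mul, TensorProduct.add_tmul, TensorProduct.tmul_add, yδ']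
      abel)

theorem comulHom_X : comulHom X = X ⊗ₜ 1 + 1 ⊗ₜ X + δ 1 ⊗ₜ Y := lift_X ..
theorem comulHom_Y : comulHom Y = Y ⊗ₜ 1 + 1 ⊗ₜ Y := lift_Y ..
theorem comulHom_δ : comulHom (δ 1) = δ 1 ⊗ₜ 1 + 1 ⊗ₜ δ 1 := lift_δ ..

/-- The character of `H₁` with `X ↦ 0`, `δ_n ↦ 0` and `Y ↦ c`. -/
def character (c : ℂ) : H1 →ₐ[ℂ] ℂ :=
  lift 0 c 0 ∅ (by simp) (zero_mem _) (by simp) (by simp) (by simp)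

/-- The counit: the constant term. -/
def counitHom : H1 →ₐ[ℂ] ℂ := character 0

theorem character_X (c : ℂ) : character c X = 0 := by unfold character; exact lift_X ..
theorem character_Y (c : ℂ) : character c Y = c := by unfold character; exact lift_Y ..
theorem character_δ (c : ℂ) : character c (δ 1) = 0 := by unfold character; exact lift_δ ..

theorem counitHom_X : counitHom X = 0 := character_X 0
theorem counitHom_Y : counitHom Y = 0 := character_Y 0
theorem counitHom_δ : counitHom (δ 1) = 0 := character_δ 0

instance : Bialgebra ℂ H1 :=
  Bialgebra.ofAlgHom comulHom counitHom
    (algHom_ext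
      (by
        simp [comulHom_X, comulHom_Y, comulHom_δ, TensorProduct.add_tmul, TensorProduct.tmul_add,
          Algebra.TensorProduct.one_def]
        abel)
      (by simp [comulHom_Y, TensorProduct.add_tmul, TensorProduct.tmul_add,
          Algebra.TensorProduct.one_def, add_assoc])
      (by simp [comulHom_δ, TensorProduct.add_tmul, TensorProduct.tmul_add,
          Algebra.TensorProduct.one_def, add_assoc]))
    (algHom_ext (by simp [comulHom_X, counitHom_X, counitHom_δ])
      (by simp [comulHom_Y, counitHom_Y]) (by simp [comulHom_δ, counitHom_δ]))
    (algHom_ext (by simp [comulHom_X, counitHom_X, counitHom_Y])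
      (by simp [comulHom_Y, counitHom_Y]) (by simp [comulHom_δ, counitHom_δ]))

open MulOpposite in
/-- The antipode, as an algebra homomorphism to the opposite algebra. -/
def antipodeHom : H1 →ₐ[ℂ] H1ᵐᵒᵖ :=
  lift (op (-X + δ 1 * Y)) (op (-Y)) (op (-δ 1))
    (Set.range fun n ↦ op (δ n))
    (by
      rintro a ⟨n, rfl⟩ b ⟨m, rfl⟩
      simp [← op_mul, δδ m n])
    (neg_mem (Algebra.subset_adjoin ⟨1, rfl⟩))
    (by
      have hA (n : ℕ+) : op (δ n) ∈ Algebra.adjoin ℂ (Set.range fun n ↦ op (δ n)) :=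
        Algebra.subset_adjoin ⟨n, rfl⟩
      rintro t ⟨n, rfl⟩
      convert sub_mem (hA (n + 1))
        (Subalgebra.smul_mem _ (mul_mem (hA n) (hA 1)) ((n : ℕ) : ℂ)) using 1
      rw [← op_mul, ← op_mul, ← op_mul, ← op_smul, ← op_sub, ← op_sub, ← xδ,
        ← mul_smul_comm, ← yδ]
      congr 1
      simp only [mul_add, add_mul, mul_sub, mul_neg, neg_mul, ← mul_assoc, δδ 1 n]
      abel)
    (by
      rw [← op_mul, ← op_mul, ← op_sub]
      congr 1
      rw [mul_add, add_mul, ← mul_assoc]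
      simp only [mul_neg, neg_mul, yx', yδ', add_mul]
      abel)
    (by
      rw [← op_mul, ← op_mul, ← op_sub]
      congr 1
      simp only [neg_mul_neg, yδ']
      abel)

open MulOpposite in
theorem antipodeHom_X : antipodeHom X = op (-X + δ 1 * Y) := lift_X ..
open MulOpposite in
theorem antipodeHom_Y : antipodeHom Y = op (-Y) := lift_Y ..
open MulOpposite in
theorem antipodeHom_δ : antipodeHom (δ 1) = op (-δ 1) := lift_δ ..

/-- The antipode as a linear map. -/
def antipodeLin : H1 →ₗ[ℂ] H1 :=
  (MulOpposite.opLinearEquiv ℂ).symm.toLinearMap ∘ₗ antipodeHom.toLinearMap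

theorem antipodeLin_apply (h : H1) : antipodeLin h = (antipodeHom h).unop := rfl

theorem antipodeLin_mul (a b : H1) : antipodeLin (a * b) = antipodeLin b * antipodeLin a := by
  simp [antipodeLin_apply]

theorem antipodeLin_X : antipodeLin X = -X + δ 1 * Y := by
  rw [antipodeLin_apply, antipodeHom_X]; rfl

theorem antipodeLin_Y : antipodeLin Y = -Y := by
  rw [antipodeLin_apply, antipodeHom_Y]; rfl

theorem antipodeLin_δ : antipodeLin (δ 1) = -δ 1 := by
  rw [antipodeLin_apply, antipodeHom_δ]; rfl

theorem antipodeLin_one : antipodeLin 1 = 1 := by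
  simp [antipodeLin_apply]

theorem antipode_left (h : H1) : LinearMap.mul' ℂ H1 (antipodeLin.rTensor H1 (comulHom h)) =
    algebraMap ℂ H1 (counitHom h) := by
  induction h using induction with
  | hc c => simp [Algebra.algebraMap_eq_smul_one, Algebra.TensorProduct.one_def, antipodeLin_one]
  | hX =>
    simp [comulHom_X, counitHom_X, antipodeLin_X, antipodeLin_one, antipodeLin_δ]
  | hY => simp [comulHom_Y, counitHom_Y, antipodeLin_Y, antipodeLin_one]
  | hδ => simp [comulHom_δ, counitHom_δ, antipodeLin_δ, antipodeLin_one]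
  | hadd a b ha hb => simp [ha, hb]
  | hmul a b ha hb =>
    have key : ∀ t u : H1 ⊗[ℂ] H1, ∀ e : ℂ,
        LinearMap.mul' ℂ H1 (antipodeLin.rTensor H1 t) = algebraMap ℂ H1 e →
        LinearMap.mul' ℂ H1 (antipodeLin.rTensor H1 (t * u)) =
          e • LinearMap.mul' ℂ H1 (antipodeLin.rTensor H1 u) := by
      intro t u e ht
      induction u with
      | zero => simp
      | add u v hu hv => rw [mul_add]; simp only [map_add, smul_add, hu, hv]
      | tmul c d =>
        have : LinearMap.mul' ℂ H1 (antipodeLin.rTensor H1 (t * c ⊗ₜ[ℂ] d)) =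
            antipodeLin c * LinearMap.mul' ℂ H1 (antipodeLin.rTensor H1 t) * d := by
          clear ht
          induction t with
          | zero => simp
          | add t s ht hs => rw [add_mul]; simp only [map_add, mul_add, add_mul, ht, hs]
          | tmul p q => simp [antipodeLin_mul, mul_assoc]
        rw [this, ht]
        simp [Algebra.algebraMap_eq_smul_one]
    rw [map_mul, key _ _ _ ha, hb, map_mul, map_mul, Algebra.smul_def]

theorem antipode_right (h : H1) : LinearMap.mul' ℂ H1 (antipodeLin.lTensor H1 (comulHom h)) =
    algebraMap ℂ H1 (counitHom h) := by
  induction h using induction with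
  | hc c => simp [Algebra.algebraMap_eq_smul_one, Algebra.TensorProduct.one_def, antipodeLin_one]
  | hX =>
    simp [comulHom_X, counitHom_X, antipodeLin_X, antipodeLin_one, antipodeLin_Y]
  | hY => simp [comulHom_Y, counitHom_Y, antipodeLin_Y, antipodeLin_one]
  | hδ => simp [comulHom_δ, counitHom_δ, antipodeLin_δ, antipodeLin_one]
  | hadd a b ha hb => simp [ha, hb]
  | hmul a b ha hb =>
    have key : ∀ t u : H1 ⊗[ℂ] H1, ∀ e : ℂ,
        LinearMap.mul' ℂ H1 (antipodeLin.lTensor H1 u) = algebraMap ℂ H1 e →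
        LinearMap.mul' ℂ H1 (antipodeLin.lTensor H1 (t * u)) =
          e • LinearMap.mul' ℂ H1 (antipodeLin.lTensor H1 t) := by
      intro t u e hu
      induction t with
      | zero => simp
      | add t s ht hs => rw [add_mul]; simp only [map_add, smul_add, ht, hs]
      | tmul c d =>
        have : LinearMap.mul' ℂ H1 (antipodeLin.lTensor H1 (c ⊗ₜ[ℂ] d * u)) =
            c * LinearMap.mul' ℂ H1 (antipodeLin.lTensor H1 u) * antipodeLin d := by
          clear hu
          induction u with
          | zero => simp
          | add t s ht hs => rw [mul_add]; simp only [map_add, mul_add, add_mul, ht, hs]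
          | tmul p q => simp [antipodeLin_mul, mul_assoc]
        rw [this, hu]
        simp [Algebra.algebraMap_eq_smul_one]
    rw [map_mul, key _ _ _ hb, ha, map_mul, map_mul, Algebra.smul_def, Algebra.commutes]

instance : HopfAlgebra ℂ H1 where
  antipode := antipodeLin
  mul_antipode_rTensor_comul := LinearMap.ext antipode_left
  mul_antipode_lTensor_comul := LinearMap.ext antipode_right

/-- The modular character `ν`: `ν(Y) = 1`, `ν(X) = ν(δ_n) = 0`. -/
def ν : H1 →ₐ[ℂ] ℂ := character 1

/-- The cochain `X ⊗ Y - Y ⊗ X - δ₁ Y ⊗ Y`. -/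
def fundamental : H1 ⊗[ℂ] H1 := X ⊗ₜ Y - Y ⊗ₜ X - (δ 1 * Y) ⊗ₜ Y

end H1

section HopfCyclic

open Coalgebra HopfAlgebra

variable (H : Type*) [Ring H] [HopfAlgebra ℂ H]

/-- A Hopf action of `H` on an algebra `A`: an `H`-module structure with
`h(ab) = ∑ h₍₁₎(a) h₍₂₎(b)` and `h(1) = ε(h) 1`. -/
structure HopfAction (A : Type*) [Ring A] [Algebra ℂ A] where
  /-- the operators on `A` -/
  act : H →ₐ[ℂ] Module.End ℂ A
  act_mul (h : H) (a b : A) : act h (a * b) =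
    LinearMap.mul' ℂ A (TensorProduct.map (act.toLinearMap.flip a) (act.toLinearMap.flip b)
      (comul (R := ℂ) h))
  act_one (h : H) : act h 1 = counit (R := ℂ) h • (1 : A)

variable {H}

/-- The twisted antipode `∑ ν(h₍₁₎) S(h₍₂₎)`. -/
def twistedAntipode (ν : H →ₐ[ℂ] ℂ) : H →ₗ[ℂ] H :=
  LinearMap.mul' ℂ H ∘ₗ TensorProduct.map (Algebra.linearMap ℂ H ∘ₗ ν.toLinearMap) (antipode ℂ) ∘ₗ
    comul

variable (H)

/-- `b(h) = 1 ⊗ h - Δ h + h ⊗ 1`. -/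
def hopfB1 : H →ₗ[ℂ] H ⊗[ℂ] H :=
  TensorProduct.mk ℂ H H 1 - comul + (TensorProduct.mk ℂ H H).flip 1

/-- `b(h ⊗ k) = 1 ⊗ h ⊗ k - Δ h ⊗ k + h ⊗ Δ k - h ⊗ k ⊗ 1`. -/
def hopfB2 : H ⊗[ℂ] H →ₗ[ℂ] H ⊗[ℂ] (H ⊗[ℂ] H) :=
  TensorProduct.mk ℂ H (H ⊗[ℂ] H) 1
    - (TensorProduct.assoc ℂ H H H).toLinearMap ∘ₗ comul.rTensor H
    + comul.lTensor H
    - ((TensorProduct.mk ℂ H H).flip 1).lTensor H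

variable {H}

/-- The operator `B = A ∘ B₀` on `2`-cochains, where `B₀(h ⊗ k) = S̃(h) k` and `A = 1 - S̃`. -/
def connesB (ν : H →ₐ[ℂ] ℂ) : H ⊗[ℂ] H →ₗ[ℂ] H :=
  (LinearMap.id - twistedAntipode ν) ∘ₗ LinearMap.mul' ℂ H ∘ₗ (twistedAntipode ν).rTensor H

/-- Normalized `2`-cochains: those killed by both degeneracies. -/
def normalized2 (H : Type*) [Ring H] [HopfAlgebra ℂ H] : Submodule ℂ (H ⊗[ℂ] H) :=
  LinearMap.ker ((TensorProduct.lid ℂ H).toLinearMap ∘ₗ counit.rTensor H) ⊓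
    LinearMap.ker ((TensorProduct.rid ℂ H).toLinearMap ∘ₗ counit.lTensor H)

/-- The `2`-cocycles of the total complex of the normalized `(b, B)`-bicomplex of `(H, ν)`: pairs
`(c, s)` of a normalized `2`-cochain and a `0`-cochain with `b c = 0` and `B c + b s = B c = 0`. -/
def HopfCyclicZ2 (ν : H →ₐ[ℂ] ℂ) : Submodule ℂ ((H ⊗[ℂ] H) × ℂ) :=
  (normalized2 H ⊓ LinearMap.ker (hopfB2 H) ⊓ LinearMap.ker (connesB ν)).comap
    (LinearMap.fst ℂ (H ⊗[ℂ] H) ℂ)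

/-- The `2`-coboundaries: the pairs `(b h, B h) = (b h, ν(h))` with `ε(h) = 0`. -/
def HopfCyclicB2 (ν : H →ₐ[ℂ] ℂ) : Submodule ℂ ((H ⊗[ℂ] H) × ℂ) :=
  (LinearMap.ker (counit (R := ℂ) (A := H))).map ((hopfB1 H).prod ν.toLinearMap)

/-- The Hopf cyclic cohomology group `HC²` of `(H, ν)`. -/
abbrev HopfCyclicHC2 (ν : H →ₐ[ℂ] ℂ) : Type _ :=
  HopfCyclicZ2 ν ⧸ (HopfCyclicB2 ν).submoduleOf (HopfCyclicZ2 ν)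

variable (A : Type*) [Ring A] [Algebra ℂ A]

/-- The Hochschild coboundary `(bψ)(a, b) = a ψ(b) - ψ(ab) + ψ(a) b`. -/
def hochB1 : (A →ₗ[ℂ] A) →ₗ[ℂ] (A →ₗ[ℂ] A →ₗ[ℂ] A) where
  toFun ψ := LinearMap.mk₂ ℂ (fun a b ↦ a * ψ b - ψ (a * b) + ψ a * b)
    (by intros; simp [add_mul]; abel) (by intros; simp [smul_add, smul_sub])
    (by intros; simp [mul_add]; abel) (by intros; simp [smul_add, smul_sub])
  map_add' := by intros; ext; simp [mul_add, add_mul]; abel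
  map_smul' := by intros; ext; simp [smul_add, smul_sub]

/-- Hochschild `2`-cocycles of `A` with values in `A`. -/
def HochZ2 : Submodule ℂ (A →ₗ[ℂ] A →ₗ[ℂ] A) where
  carrier := {φ | ∀ a b c, a * φ b c - φ (a * b) c + φ a (b * c) - φ a b * c = 0}
  add_mem' {φ ψ} hφ hψ a b c := by
    have := congrArg₂ (· + ·) (hφ a b c) (hψ a b c)
    simp only [add_zero] at this
    rw [← this]
    simp only [LinearMap.add_apply, mul_add, add_mul]
    abel
  zero_mem' := by simp
  smul_mem' r φ hφ a b c := by
    have := congrArg (r • ·) (hφ a b c)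
    simpa [smul_add, smul_sub] using this

set_option maxSynthPendingDepth 5 in
/-- The Hochschild cohomology group `HH²(A, A)`. -/
def HochHH2 : Type _ := HochZ2 A ⧸ (LinearMap.range (hochB1 A)).submoduleOf (HochZ2 A)

set_option maxSynthPendingDepth 5 in
instance : AddCommGroup (HochHH2 A) :=
  inferInstanceAs (AddCommGroup (HochZ2 A ⧸ (LinearMap.range (hochB1 A)).submoduleOf (HochZ2 A)))

set_option maxSynthPendingDepth 5 in
instance : Module ℂ (HochHH2 A) :=
  inferInstanceAs (Module ℂ (HochZ2 A ⧸ (LinearMap.range (hochB1 A)).submoduleOf (HochZ2 A)))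

set_option maxSynthPendingDepth 5 in
/-- The class of a Hochschild cocycle. -/
def HochHH2.mk : HochZ2 A →ₗ[ℂ] HochHH2 A :=
  ((LinearMap.range (hochB1 A)).submoduleOf (HochZ2 A)).mkQ

variable {A}

namespace HopfAction

variable (ρ : HopfAction H A)

/-- `χ(h ⊗ k)(a, b) = h(a) k(b)`. -/
def chi : H ⊗[ℂ] H →ₗ[ℂ] (A →ₗ[ℂ] A →ₗ[ℂ] A) :=
  TensorProduct.lift (LinearMap.mk₂ ℂ
    (fun h k ↦ (LinearMap.mul ℂ A).compl₁₂ (ρ.act h) (ρ.act k))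
    (by intros; ext; simp) (by intros; ext; simp)
    (by intros; ext; simp [mul_add]) (by intros; ext; simp))

theorem chi_tmul (h k : H) (a b : A) : ρ.chi (h ⊗ₜ k) a b = ρ.act h a * ρ.act k b := rfl

theorem chi_eq (t : H ⊗[ℂ] H) (a b : A) : ρ.chi t a b = LinearMap.mul' ℂ A
    (TensorProduct.map (ρ.act.toLinearMap.flip a) (ρ.act.toLinearMap.flip b) t) := by
  induction t with
  | zero => simp
  | add s t hs ht => simp [hs, ht]
  | tmul h k => simp [chi_tmul]

theorem act_mul' (h : H) (a b : A) : ρ.act h (a * b) = ρ.chi (comul (R := ℂ) h) a b := by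
  rw [chi_eq, act_mul]

theorem chi_hopfB1 (h : H) : ρ.chi (hopfB1 H h) = hochB1 A (ρ.act h) := by
  ext a b
  simp [hopfB1, hochB1, chi_tmul, act_mul']

/-- `χ` in degree `3`. -/
def chi3 (a b c : A) : H ⊗[ℂ] (H ⊗[ℂ] H) →ₗ[ℂ] A :=
  LinearMap.mul' ℂ A ∘ₗ TensorProduct.map (ρ.act.toLinearMap.flip a)
    (LinearMap.applyₗ c ∘ₗ LinearMap.applyₗ b ∘ₗ ρ.chi)

theorem chi3_tmul (a b c : A) (h : H) (t : H ⊗[ℂ] H) :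
    ρ.chi3 a b c (h ⊗ₜ t) = ρ.act h a * ρ.chi t b c := by
  simp [chi3]

theorem chi3_hopfB2 (t : H ⊗[ℂ] H) (a b c : A) : ρ.chi3 a b c (hopfB2 H t) =
    a * ρ.chi t b c - ρ.chi t (a * b) c + ρ.chi t a (b * c) - ρ.chi t a b * c := by
  induction t with
  | zero => simp
  | add s t hs ht =>
    simp only [map_add, hs, ht, LinearMap.add_apply, mul_add, add_mul]
    abel
  | tmul h k =>
    have key : ∀ s : H ⊗[ℂ] H, ρ.chi3 a b c (TensorProduct.assoc ℂ H H H (s ⊗ₜ k)) =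
        ρ.chi s a b * ρ.act k c := by
      intro s
      induction s with
      | zero => simp
      | add s t hs ht => simp [TensorProduct.add_tmul, hs, ht, add_mul]
      | tmul x y => simp [chi3_tmul, chi_tmul, mul_assoc]
    simp [hopfB2, chi3_tmul, chi_tmul, act_mul', key, mul_assoc]

theorem chi_mem {t : H ⊗[ℂ] H} (ht : hopfB2 H t = 0) : ρ.chi t ∈ HochZ2 A := fun a b c ↦ by
  rw [← chi3_hopfB2, ht, map_zero]

set_option maxSynthPendingDepth 5 in
/-- The canonical map from Hopf cyclic cohomology to the Hochschild cohomology of `A`, induced by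
`(c, s) ↦ χ(c)`. -/
def charMap (ν : H →ₐ[ℂ] ℂ) : HopfCyclicHC2 ν →ₗ[ℂ] HochHH2 A :=
  Submodule.mapQ _ ((LinearMap.range (hochB1 A)).submoduleOf (HochZ2 A))
    ((ρ.chi ∘ₗ LinearMap.fst ℂ (H ⊗[ℂ] H) ℂ ∘ₗ (HopfCyclicZ2 ν).subtype).codRestrict (HochZ2 A)
      fun c ↦ ρ.chi_mem c.2.1.2)
    (by
      rintro ⟨c, hc⟩ hc'
      obtain ⟨h, -, hh⟩ : c ∈ HopfCyclicB2 ν := hc'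
      exact ⟨ρ.act h, by rw [← chi_hopfB1]; exact congrArg (fun p ↦ ρ.chi p.1) hh⟩)

end HopfAction

end HopfCyclic

section Forms

open UpperHalfPlane hiding I
open Matrix.SpecialLinearGroup CongruenceSubgroup
open scoped MatrixGroups ModularForm DirectSum Pointwise

/-- The group `G⁺(ℚ) = GL⁺(2, ℚ)`. -/
abbrev GQ : Type := Matrix.GLPos (Fin 2) ℚ

/-- The inclusion of `GL⁺(2, ℚ)` in `GL(2, ℝ)`. -/
def toGLR : GQ →* GL (Fin 2) ℝ :=
  (Matrix.GeneralLinearGroup.map (Rat.castHom ℝ)).comp (Matrix.GLPos (Fin 2) ℚ).subtype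

/-- The inclusion of `SL(2, ℤ)` in `GL⁺(2, ℚ)`. -/
def ofSL : SL(2, ℤ) →* GQ := toGLPos.comp (Matrix.SpecialLinearGroup.map (Int.castRingHom ℚ))

theorem toGLR_ofSL (γ : SL(2, ℤ)) : toGLR (ofSL γ) = mapGL ℝ γ := by
  ext i j
  simp [toGLR, ofSL]

/-- The determinant, as a positive real number. -/
def rdet (α : GQ) : ℝ := ((toGLR α).det : ℝ)

theorem rdet_pos (α : GQ) : 0 < rdet α := by
  have := α.2
  rw [Matrix.mem_glpos] at this
  have h : rdet α = (((α : GL (Fin 2) ℚ).det : ℚ) : ℝ) := by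
    simp [rdet, toGLR, Matrix.det_fin_two]
  rw [h]
  exact_mod_cast this

theorem rdet_mul (α β : GQ) : rdet (α * β) = rdet α * rdet β := by
  simp [rdet]

theorem rdet_ofSL (γ : SL(2, ℤ)) : rdet (ofSL γ) = 1 := by
  simp [rdet, toGLR_ofSL]

/-- The slash operator `(f|_k α)(z) = det(α)^{k/2} f(α z) (cz + d)^{-k}`. -/
def slash (k : ℤ) (f : ℍ → ℂ) (α : GQ) : ℍ → ℂ := fun z ↦
  ((rdet α ^ ((k : ℝ) / 2) : ℝ) : ℂ) * f (toGLR α • z) * denom (toGLR α) z ^ (-k)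

theorem slash_eq (k : ℤ) (f : ℍ → ℂ) (α : GQ) :
    slash k f α = ((rdet α ^ (1 - (k : ℝ) / 2) : ℝ) : ℂ) • (f ∣[k] toGLR α) := by
  ext z
  have h := rdet_pos α
  have h1 : rdet α ^ ((k : ℝ) / 2) = rdet α ^ (1 - (k : ℝ) / 2) * rdet α ^ (k - 1) := by
    rw [← Real.rpow_intCast, ← Real.rpow_add h]
    congr 1
    push_cast
    ring
  have h2 : σ (toGLR α) (f (toGLR α • z)) = f (toGLR α • z) := by
    rw [σ, if_pos (show 0 < (toGLR α).det.val from h)]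
    rfl
  rw [Pi.smul_apply, ModularForm.slash_apply, h2, slash, h1,
    show (toGLR α).det.val = rdet α from rfl, abs_of_pos h, smul_eq_mul]
  push_cast
  ring

theorem slash_add (k : ℤ) (f g : ℍ → ℂ) (α : GQ) :
    slash k (f + g) α = slash k f α + slash k g α := by
  ext z
  simp only [slash, Pi.add_apply]
  ring

theorem slash_smul (k : ℤ) (c : ℂ) (f : ℍ → ℂ) (α : GQ) :
    slash k (c • f) α = c • slash k f α := by
  ext z
  simp only [slash, Pi.smul_apply, smul_eq_mul]
  ring

theorem slash_mul (k l : ℤ) (f g : ℍ → ℂ) (α : GQ) :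
    slash (k + l) (f * g) α = slash k f α * slash l g α := by
  ext z
  have h : rdet α ^ (((k + l : ℤ) : ℝ) / 2) = rdet α ^ ((k : ℝ) / 2) * rdet α ^ ((l : ℝ) / 2) := by
    rw [← Real.rpow_add (rdet_pos α)]
    congr 1
    push_cast
    ring
  simp only [slash, Pi.mul_apply, h, neg_add, zpow_add₀ (denom_ne_zero (toGLR α) z)]
  push_cast
  ring

theorem slash_slash (k : ℤ) (f : ℍ → ℂ) (α β : GQ) :
    slash k (slash k f α) β = slash k f (α * β) := by
  have hσ (c : ℂ) : σ (toGLR β) c = c := by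
    rw [σ, if_pos (show 0 < (toGLR β).det.val from rdet_pos β)]
    rfl
  rw [slash_eq, slash_eq, slash_eq, ModularForm.smul_slash, hσ, ← SlashAction.slash_mul, smul_smul,
    map_mul, rdet_mul, Real.mul_rpow (rdet_pos α).le (rdet_pos β).le]
  push_cast
  rw [mul_comm]

theorem slash_one' (k : ℤ) (f : ℍ → ℂ) : slash k f 1 = f := by
  ext z
  simp [slash, rdet]

theorem slash_ofSL (k : ℤ) (f : ℍ → ℂ) (γ : SL(2, ℤ)) :
    slash k f (ofSL γ) = f ∣[k] (mapGL ℝ γ : GL (Fin 2) ℝ) := by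
  rw [slash_eq, rdet_ofSL, toGLR_ofSL]
  simp

/-- A modular form for `𝒢` is one for each smaller group. -/
def restrictMF {𝒢 𝒢' : Subgroup (GL (Fin 2) ℝ)} (h : 𝒢' ≤ 𝒢) {k : ℤ} (f : ModularForm 𝒢 k) :
    ModularForm 𝒢' k where
  toFun := f
  slash_action_eq' γ hγ := f.slash_action_eq' γ (h hγ)
  holo' := f.holo'
  bdd_at_cusps' hc := f.bdd_at_cusps' (hc.mono h)

/-- A cusp form for `𝒢` is one for each smaller group. -/
def restrictCF {𝒢 𝒢' : Subgroup (GL (Fin 2) ℝ)} (h : 𝒢' ≤ 𝒢) {k : ℤ} (f : CuspForm 𝒢 k) :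
    CuspForm 𝒢' k where
  toFun := f
  slash_action_eq' γ hγ := f.slash_action_eq' γ (h hγ)
  holo' := f.holo'
  zero_at_cusps' hc := f.zero_at_cusps' (hc.mono h)

theorem Gamma_le_of_dvd {N M : ℕ} (h : N ∣ M) : Gamma M ≤ Gamma N := by
  obtain ⟨c, rfl⟩ := h
  intro γ hγ
  rw [Gamma_mem] at hγ ⊢
  have key : ∀ a b : ℤ, (a : ZMod (N * c)) = b → (a : ZMod N) = b := fun a b hab ↦ by
    rw [ZMod.intCast_eq_intCast_iff_dvd_sub] at hab ⊢
    exact (Dvd.intro _ (by push_cast; rfl)).trans hab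
  exact ⟨by simpa using key _ 1 (by simpa using hγ.1), by simpa using key _ 0 (by simpa using hγ.2.1),
    by simpa using key _ 0 (by simpa using hγ.2.2.1), by simpa using key _ 1 (by simpa using hγ.2.2.2)⟩

theorem GammaGL_le_of_dvd {N M : ℕ} (h : N ∣ M) :
    (Gamma M).map (mapGL ℝ) ≤ (Gamma N).map (mapGL ℝ) :=
  Subgroup.map_mono (Gamma_le_of_dvd h)

/-- `M_k`: the modular forms of weight `k` and arbitrary level. -/
def formSpace (k : ℤ) : Submodule ℂ (ℍ → ℂ) where
  carrier := {f | ∃ N : ℕ, N ≠ 0 ∧ ∃ g : ModularForm ((Gamma N).map (mapGL ℝ)) k, ⇑g = f}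
  add_mem' := by
    rintro _ _ ⟨N, hN, f, rfl⟩ ⟨M, hM, g, rfl⟩
    exact ⟨N * M, mul_ne_zero hN hM, restrictMF (GammaGL_le_of_dvd (dvd_mul_right N M)) f +
      restrictMF (GammaGL_le_of_dvd (dvd_mul_left M N)) g, rfl⟩
  zero_mem' := ⟨1, one_ne_zero, 0, rfl⟩
  smul_mem' := by
    rintro c _ ⟨N, hN, f, rfl⟩
    exact ⟨N, hN, c • f, rfl⟩

/-- `M_k⁰`: the cusp forms of weight `k` and arbitrary level. -/
def cuspSpace (k : ℤ) : Submodule ℂ (ℍ → ℂ) where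
  carrier := {f | ∃ N : ℕ, N ≠ 0 ∧ ∃ g : CuspForm ((Gamma N).map (mapGL ℝ)) k, ⇑g = f}
  add_mem' := by
    rintro _ _ ⟨N, hN, f, rfl⟩ ⟨M, hM, g, rfl⟩
    exact ⟨N * M, mul_ne_zero hN hM, restrictCF (GammaGL_le_of_dvd (dvd_mul_right N M)) f +
      restrictCF (GammaGL_le_of_dvd (dvd_mul_left M N)) g, rfl⟩
  zero_mem' := ⟨1, one_ne_zero, 0, rfl⟩
  smul_mem' := by
    rintro c _ ⟨N, hN, f, rfl⟩
    exact ⟨N, hN, c • f, rfl⟩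

theorem mul_mem_formSpace {k l : ℤ} {f g : ℍ → ℂ} (hf : f ∈ formSpace k) (hg : g ∈ formSpace l) :
    f * g ∈ formSpace (k + l) := by
  obtain ⟨N, hN, f, rfl⟩ := hf
  obtain ⟨M, hM, g, rfl⟩ := hg
  exact ⟨N * M, mul_ne_zero hN hM, (restrictMF (GammaGL_le_of_dvd (dvd_mul_right N M)) f).mul
    (restrictMF (GammaGL_le_of_dvd (dvd_mul_left M N)) g), rfl⟩

theorem mul_mem_cuspSpace {k l : ℤ} {f g : ℍ → ℂ} (hf : f ∈ cuspSpace k) (hg : g ∈ formSpace l) :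
    f * g ∈ cuspSpace (k + l) := by
  obtain ⟨N, hN, f, rfl⟩ := hf
  obtain ⟨M, hM, g, rfl⟩ := hg
  exact ⟨N * M, mul_ne_zero hN hM,
    (restrictCF (GammaGL_le_of_dvd (dvd_mul_right N M)) f).mulModularForm
      (restrictMF (GammaGL_le_of_dvd (dvd_mul_left M N)) g), rfl⟩

theorem exists_level (α : GQ) {N : ℕ} (hN : N ≠ 0) : ∃ M : ℕ, M ≠ 0 ∧
    (Gamma M).map (mapGL ℝ) ≤ ConjAct.toConjAct (toGLR α)⁻¹ • (Gamma N).map (mapGL ℝ) := by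
  have : NeZero N := ⟨hN⟩
  obtain ⟨M, hM, h⟩ := exists_Gamma_le_conj' (α : GL (Fin 2) ℚ) N
  refine ⟨M, hM, ?_⟩
  rw [map_inv, ← Subgroup.pointwise_smul_subset_iff]
  exact h

theorem slash_mem_formSpace {k : ℤ} {f : ℍ → ℂ} (hf : f ∈ formSpace k) (α : GQ) :
    slash k f α ∈ formSpace k := by
  obtain ⟨N, hN, f, rfl⟩ := hf
  obtain ⟨M, hM, h⟩ := exists_level α hN
  rw [slash_eq]
  exact Submodule.smul_mem _ _ ⟨M, hM, restrictMF h (ModularForm.translate f (toGLR α)), rfl⟩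

theorem slash_mem_cuspSpace {k : ℤ} {f : ℍ → ℂ} (hf : f ∈ cuspSpace k) (α : GQ) :
    slash k f α ∈ cuspSpace k := by
  obtain ⟨N, hN, f, rfl⟩ := hf
  obtain ⟨M, hM, h⟩ := exists_level α hN
  rw [slash_eq]
  exact Submodule.smul_mem _ _ ⟨M, hM, restrictCF h (CuspForm.translate f (toGLR α)), rfl⟩

instance : SetLike.GradedMonoid formSpace where
  one_mem := ⟨1, one_ne_zero, 1, rfl⟩
  mul_mem _ _ _ _ := mul_mem_formSpace

/-- The graded algebra `M = ⨁_k M_k` of modular forms of arbitrary level. -/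
abbrev Forms : Type := ⨁ k : ℤ, formSpace k

/-- The slash operator on `M_k`. -/
def slashLin (α : GQ) (k : ℤ) : formSpace k →ₗ[ℂ] formSpace k where
  toFun f := ⟨slash k f α, slash_mem_formSpace f.2 α⟩
  map_add' f g := Subtype.ext (slash_add k f g α)
  map_smul' c f := Subtype.ext (slash_smul k c f α)

/-- The action of `α ∈ G⁺(ℚ)` on `M`, in each weight by the slash operator. -/
def slashHom (α : GQ) : Forms →ₐ[ℂ] Forms :=
  DirectSum.toAlgebra ℂ (fun k ↦ formSpace k)
    (fun k ↦ DirectSum.lof ℂ ℤ (fun k ↦ formSpace k) k ∘ₗ slashLin α k)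
    (by
      have : slashLin α 0 (GradedMonoid.GOne.one (A := fun k ↦ formSpace k)) =
          GradedMonoid.GOne.one (A := fun k ↦ formSpace k) := by
        ext z
        simp [slashLin, slash, SetLike.coe_gOne]
      simp only [LinearMap.comp_apply, this]
      rfl)
    (by
      intro i j f g
      have : slashLin α (i + j) (GradedMonoid.GMul.mul (A := fun k ↦ formSpace k) f g) =
          GradedMonoid.GMul.mul (A := fun k ↦ formSpace k) (slashLin α i f) (slashLin α j g) :=
        Subtype.ext (slash_mul i j f g α)
      simp only [LinearMap.comp_apply, this]
      exact (DirectSum.of_mul_of _ _).symm)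

theorem slashHom_of (α : GQ) (k : ℤ) (f : formSpace k) :
    slashHom α (DirectSum.of (fun k ↦ formSpace k) k f) =
      DirectSum.of (fun k ↦ formSpace k) k (slashLin α k f) := by
  exact DirectSum.toAddMonoid_of (β := fun k ↦ formSpace k)
    (fun k ↦ (DirectSum.lof ℂ ℤ (fun k ↦ formSpace k) k ∘ₗ slashLin α k).toAddMonoidHom) k f

theorem slashHom_apply (α : GQ) (f : Forms) (k : ℤ) :
    ((slashHom α f k : formSpace k) : ℍ → ℂ) = slash k (f k : ℍ → ℂ) α := by
  suffices h : slashHom α f k = slashLin α k (f k) from congrArg Subtype.val h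
  induction f using DirectSum.induction_on with
  | zero => simp
  | of i x =>
    rw [slashHom_of]
    by_cases h : i = k
    · subst h; simp
    · rw [DirectSum.of_eq_of_ne _ _ _ (Ne.symm h), DirectSum.of_eq_of_ne _ _ _ (Ne.symm h), map_zero]
  | add f g hf hg => rw [map_add, DirectSum.add_apply, hf, hg, DirectSum.add_apply, map_add]

theorem forms_ext {f g : Forms} (h : ∀ k, ((f k : formSpace k) : ℍ → ℂ) = g k) : f = g :=
  DFinsupp.ext fun k ↦ Subtype.ext (h k)

theorem slashHom_slashHom (α β : GQ) (f : Forms) :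
    slashHom β (slashHom α f) = slashHom (α * β) f :=
  forms_ext fun k ↦ by simp only [slashHom_apply, slash_slash]

theorem slashHom_one (f : Forms) : slashHom 1 f = f :=
  forms_ext fun k ↦ by rw [slashHom_apply, slash_one']

end Forms

section Hecke

open UpperHalfPlane hiding I
open Matrix.SpecialLinearGroup CongruenceSubgroup
open scoped MatrixGroups ModularForm DirectSum

variable {Γ : Subgroup SL(2, ℤ)}

/-- The set `Γ \ G⁺(ℚ)` of right cosets `Γ α`. -/
abbrev Cosets (Γ : Subgroup SL(2, ℤ)) : Type := Quotient (QuotientGroup.rightRel (Γ.map ofSL))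

namespace Cosets

/-- The coset `Γ α`. -/
def coset (Γ : Subgroup SL(2, ℤ)) (α : GQ) : Cosets Γ :=
  Quotient.mk (QuotientGroup.rightRel (Γ.map ofSL)) α

theorem coset_eq {α β : GQ} : coset Γ α = coset Γ β ↔ ∃ γ ∈ Γ, ofSL γ * α = β := by
  rw [coset, coset, Quotient.eq, QuotientGroup.rightRel_apply, Subgroup.mem_map]
  simp only [eq_mul_inv_iff_mul_eq]

theorem coset_out (q : Cosets Γ) : coset Γ q.out = q := Quotient.out_eq q

theorem out_coset (α : GQ) : ∃ γ ∈ Γ, ofSL γ * α = (coset Γ α).out :=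
  coset_eq.1 (coset_out (coset Γ α)).symm

/-- Right multiplication by `β` on cosets. -/
def rmul (β : GQ) : Cosets Γ ≃ Cosets Γ where
  toFun q := coset Γ (q.out * β)
  invFun q := coset Γ (q.out * β⁻¹)
  left_inv q := by
    obtain ⟨γ, hγ, h⟩ := out_coset (Γ := Γ) (q.out * β)
    refine Eq.trans ?_ (coset_out q)
    beta_reduce
    rw [← h, ← mul_assoc, mul_inv_cancel_right]
    exact (coset_eq.2 ⟨γ, hγ, rfl⟩).symm
  right_inv q := by
    obtain ⟨γ, hγ, h⟩ := out_coset (Γ := Γ) (q.out * β⁻¹)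
    refine Eq.trans ?_ (coset_out q)
    beta_reduce
    rw [← h, ← mul_assoc, inv_mul_cancel_right]
    exact (coset_eq.2 ⟨γ, hγ, rfl⟩).symm

theorem rmul_coset (α β : GQ) : rmul β (coset Γ α) = coset Γ (α * β) := by
  obtain ⟨γ, hγ, h⟩ := out_coset (Γ := Γ) α
  rw [rmul, Equiv.coe_fn_mk, ← h, mul_assoc]
  exact (coset_eq.2 ⟨γ, hγ, rfl⟩).symm

/-- Functions on `G⁺(ℚ)` that are invariant under left translations by `Γ`. -/
def Inv {M : Type*} (Γ : Subgroup SL(2, ℤ)) (c : GQ → M) : Prop :=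
  ∀ γ ∈ Γ, ∀ β, c (ofSL γ * β) = c β

theorem Inv.out_coset {M : Type*} {c : GQ → M} (hc : Inv Γ c) (β : GQ) : c (coset Γ β).out = c β := by
  obtain ⟨γ, hγ, h⟩ := Cosets.out_coset (Γ := Γ) β
  rw [← h, hc γ hγ]

theorem Inv.rmul_out {M : Type*} {c : GQ → M} (hc : Inv Γ c) (q : Cosets Γ) (β : GQ) :
    c (rmul β q).out = c (q.out * β) :=
  hc.out_coset _

theorem Inv.sum_rmul {M : Type*} [AddCommMonoid M] {c : GQ → M} (hc : Inv Γ c) (β : GQ) :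
    ∑ᶠ q : Cosets Γ, c (q.out * β) = ∑ᶠ q : Cosets Γ, c q.out := by
  rw [← finsum_comp_equiv (rmul β) (f := fun q : Cosets Γ ↦ c q.out)]
  simp only [hc.rmul_out]

theorem Inv.sum_single {M : Type*} [AddCommMonoid M] {c : GQ → M} (hc : Inv Γ c) (β : GQ)
    (h : ∀ α, (∀ γ ∈ Γ, ofSL γ * β ≠ α) → c α = 0) : ∑ᶠ q : Cosets Γ, c q.out = c β := by
  rw [finsum_eq_single _ (coset Γ β), hc.out_coset]
  intro q hq
  refine h _ fun γ hγ e ↦ hq ?_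
  rw [← coset_out q]
  exact (coset_eq.2 ⟨γ, hγ, e⟩).symm

end Cosets

open Cosets

/-- The modular Hecke algebra `A(Γ)`: finitely supported maps `α ↦ F_α` from `Γ \ G⁺(ℚ)` to `M`
with `F_{αγ} = F_α | γ` for `γ ∈ Γ`. -/
structure HeckeAlg (Γ : Subgroup SL(2, ℤ)) where
  /-- the map `α ↦ F_α` -/
  toFun : GQ → Forms
  left' : ∀ γ ∈ Γ, ∀ α, toFun (ofSL γ * α) = toFun α
  right' : ∀ γ ∈ Γ, ∀ α, toFun (α * ofSL γ) = slashHom (ofSL γ) (toFun α)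
  fin' : {q : Cosets Γ | toFun q.out ≠ 0}.Finite

namespace HeckeAlg

instance : CoeFun (HeckeAlg Γ) fun _ ↦ GQ → Forms := ⟨toFun⟩

theorem ext {F G : HeckeAlg Γ} (h : ∀ α, F α = G α) : F = G := by
  cases F
  cases G
  congr
  exact funext h

theorem left (F : HeckeAlg Γ) : Inv Γ F := F.left'

theorem right (F : HeckeAlg Γ) {γ : SL(2, ℤ)} (hγ : γ ∈ Γ) (α : GQ) :
    F (α * ofSL γ) = slashHom (ofSL γ) (F α) := F.right' γ hγ α

theorem fin (F : HeckeAlg Γ) : {q : Cosets Γ | F q.out ≠ 0}.Finite := F.fin'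

instance : Add (HeckeAlg Γ) where
  add F G :=
    { toFun := fun α ↦ F α + G α
      left' := fun γ hγ α ↦ by simp only [F.left γ hγ, G.left γ hγ]
      right' := fun γ hγ α ↦ by simp only [F.right hγ, G.right hγ, map_add]
      fin' := (F.fin.union G.fin).subset fun q hq ↦ by
        by_contra h
        have h1 : F q.out = 0 := by_contra fun h1 ↦ h (Or.inl h1)
        have h2 : G q.out = 0 := by_contra fun h1 ↦ h (Or.inr h1)
        exact hq (by rw [h1, h2, add_zero]) }

/-- Apply a linear map that commutes with the slash operators to all values. -/
def mapLin (T : Forms →ₗ[ℂ] Forms) (hT : ∀ α f, T (slashHom α f) = slashHom α (T f))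
    (F : HeckeAlg Γ) : HeckeAlg Γ where
  toFun α := T (F α)
  left' γ hγ α := by rw [F.left γ hγ]
  right' γ hγ α := by rw [F.right hγ, hT]
  fin' := F.fin.subset fun q hq h ↦ hq (by rw [h, map_zero])

instance : Zero (HeckeAlg Γ) where
  zero :=
    { toFun := fun _ ↦ 0
      left' := fun _ _ _ ↦ rfl
      right' := fun _ _ _ ↦ (map_zero _).symm
      fin' := by simp }

instance : SMul ℂ (HeckeAlg Γ) where
  smul c F := mapLin (c • LinearMap.id) (fun α f ↦ by simp) F

instance : Neg (HeckeAlg Γ) where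
  neg F := (-1 : ℂ) • F

theorem add_apply (F G : HeckeAlg Γ) (α : GQ) : (F + G) α = F α + G α := rfl

theorem neg_apply (F : HeckeAlg Γ) (α : GQ) : (-F) α = -F α := neg_one_smul ℂ (F α)

theorem zero_apply (α : GQ) : (0 : HeckeAlg Γ) α = 0 := rfl

theorem smul_apply (c : ℂ) (F : HeckeAlg Γ) (α : GQ) : (c • F) α = c • F α := rfl

instance : AddCommGroup (HeckeAlg Γ) where
  add_assoc _ _ _ := ext fun _ ↦ add_assoc _ _ _
  zero_add _ := ext fun _ ↦ zero_add _
  add_zero _ := ext fun _ ↦ add_zero _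
  add_comm _ _ := ext fun _ ↦ add_comm _ _
  neg_add_cancel F := ext fun α ↦ by rw [add_apply, neg_apply, neg_add_cancel, zero_apply]
  nsmul := nsmulRec
  zsmul := zsmulRec

instance : Module ℂ (HeckeAlg Γ) where
  one_smul F := ext fun α ↦ one_smul ℂ (F α)
  mul_smul c d F := ext fun α ↦ mul_smul c d (F α)
  smul_zero c := ext fun _ ↦ smul_zero (A := Forms) c
  smul_add c F G := ext fun α ↦ smul_add c (F α) (G α)
  add_smul c d F := ext fun α ↦ add_smul c d (F α)
  zero_smul F := ext fun α ↦ zero_smul ℂ (F α)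

/-- The summand `F_β · G_{αβ⁻¹} | β` of the product. -/
def term (F G : GQ → Forms) (α β : GQ) : Forms := F β * slashHom β (G (α * β⁻¹))

theorem term_inv (F G : HeckeAlg Γ) (α : GQ) : Inv Γ (term F G α) := by
  intro γ hγ β
  have h := G.right (Γ.inv_mem hγ) (α * β⁻¹)
  rw [map_inv, mul_assoc, ← mul_inv_rev] at h
  rw [term, term, F.left γ hγ, h, slashHom_slashHom, inv_mul_cancel_left]

theorem term_fin (F : HeckeAlg Γ) (G : GQ → Forms) (α : GQ) :
    Function.HasFiniteSupport fun q : Cosets Γ ↦ term F G α q.out :=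
  F.fin.subset fun q hq h ↦ hq (by simp [term, h])

/-- The product `(F * G)_α = ∑_{β ∈ Γ \ G⁺(ℚ)} F_β · G_{αβ⁻¹} | β`. -/
def mulFun (F G : HeckeAlg Γ) (α : GQ) : Forms := ∑ᶠ q : Cosets Γ, term F G α q.out

theorem mulFun_left (F G : HeckeAlg Γ) : Inv Γ (mulFun F G) := by
  intro γ hγ α
  simp only [mulFun, term, mul_assoc, G.left γ hγ]

instance : Mul (HeckeAlg Γ) where
  mul F G :=
    { toFun := mulFun F G
      left' := mulFun_left F G
      right' := fun γ hγ α ↦ by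
        rw [mulFun, ← (term_inv F G _).sum_rmul (ofSL γ), mulFun, map_finsum _ (term_fin F G α)]
        congr 1
        ext1 q
        rw [term, term, F.right hγ, map_mul, slashHom_slashHom, mul_inv_rev, mul_assoc,
          mul_inv_cancel_left]
      fin' := by
        refine ((F.fin.prod G.fin).image fun p ↦ rmul p.1.out p.2).subset fun q hq ↦ ?_
        obtain ⟨p, hp⟩ : ∃ p : Cosets Γ, term F G q.out p.out ≠ 0 := by
          by_contra! h
          exact hq (by simp [mulFun, h])
        refine ⟨(p, coset Γ (q.out * p.out⁻¹)), ⟨fun h ↦ hp (by simp [term, h]), fun h ↦ hp ?_⟩, ?_⟩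
        · rw [G.left.out_coset] at h
          simp [term, h]
        · simp [rmul_coset, coset_out] }

theorem mul_apply (F G : HeckeAlg Γ) (α : GQ) :
    (F * G) α = ∑ᶠ q : Cosets Γ, F q.out * slashHom q.out (G (α * q.out⁻¹)) := rfl

open Classical in
/-- A `Γ`-invariant element `x` of `M`, as the element of `A(Γ)` with the value `x` on `Γ` and `0`
elsewhere. -/
def ofInvariant (Γ : Subgroup SL(2, ℤ)) (x : Forms)
    (hx : ∀ γ ∈ Γ, slashHom (ofSL γ) x = x) : HeckeAlg Γ where
  toFun α := if α ∈ Γ.map ofSL then x else 0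
  left' γ hγ α := by
    simp only [Subgroup.mul_mem_cancel_left _ (Subgroup.mem_map_of_mem ofSL hγ)]
  right' γ hγ α := by
    simp only [Subgroup.mul_mem_cancel_right _ (Subgroup.mem_map_of_mem ofSL hγ)]
    split_ifs
    · rw [hx γ hγ]
    · rw [map_zero]
  fin' := by
    refine (Set.finite_singleton (coset Γ 1)).subset fun q hq ↦ ?_
    have h : q.out ∈ Γ.map ofSL := by
      by_contra h
      exact hq (if_neg h)
    obtain ⟨γ, hγ, h⟩ := h
    rw [Set.mem_singleton_iff, ← coset_out q]
    exact (coset_eq.2 ⟨γ, hγ, by rw [mul_one, h]⟩).symm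

theorem ofInvariant_apply_mem {x : Forms} {hx : ∀ γ ∈ Γ, slashHom (ofSL γ) x = x} {α : GQ}
    (h : α ∈ Γ.map ofSL) : ofInvariant Γ x hx α = x := if_pos h

theorem ofInvariant_apply_notMem {x : Forms} {hx : ∀ γ ∈ Γ, slashHom (ofSL γ) x = x} {α : GQ}
    (h : α ∉ Γ.map ofSL) : ofInvariant Γ x hx α = 0 := if_neg h

instance : One (HeckeAlg Γ) := ⟨ofInvariant Γ 1 fun _ _ ↦ map_one _⟩

theorem one_apply_mem {α : GQ} (h : α ∈ Γ.map ofSL) : (1 : HeckeAlg Γ) α = 1 := if_pos h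

theorem one_apply_notMem {α : GQ} (h : α ∉ Γ.map ofSL) : (1 : HeckeAlg Γ) α = 0 := if_neg h

protected theorem one_mul (F : HeckeAlg Γ) : 1 * F = F := by
  refine ext fun α ↦ ((term_inv 1 F α).sum_single 1 fun β hβ ↦ ?_).trans ?_
  · rw [term, one_apply_notMem, zero_mul]
    rintro ⟨γ, hγ, h⟩
    exact hβ γ hγ (by rw [mul_one, h])
  · rw [term, one_apply_mem (one_mem _), one_mul, inv_one, mul_one, slashHom_one]

protected theorem mul_one (F : HeckeAlg Γ) : F * 1 = F := by
  refine ext fun α ↦ ((term_inv F 1 α).sum_single α fun β hβ ↦ ?_).trans ?_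
  · rw [term, one_apply_notMem, map_zero, mul_zero]
    rintro ⟨γ, hγ, h⟩
    exact hβ γ⁻¹ (Γ.inv_mem hγ) (by rw [map_inv, h]; group)
  · rw [term, mul_inv_cancel, one_apply_mem (one_mem _), map_one, mul_one]

protected theorem mul_assoc (F G K : HeckeAlg Γ) : F * G * K = F * (G * K) := by
  refine ext fun α ↦ ?_
  let d : Cosets Γ → Cosets Γ → Forms := fun b c ↦
    F c.out * slashHom c.out (G (b.out * c.out⁻¹)) * slashHom b.out (K (α * b.out⁻¹))
  have h1 : (F * G * K) α = ∑ᶠ b, ∑ᶠ c, d b c := by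
    rw [mul_apply]
    congr 1
    ext1 b
    exact finsum_mul' _ _ (term_fin F G b.out)
  have h2 : (F * (G * K)) α = ∑ᶠ c, ∑ᶠ b, d b c := by
    rw [mul_apply]
    congr 1
    ext1 c
    have hinv : Inv Γ fun β ↦
        F c.out * slashHom c.out (term G K (α * c.out⁻¹) (β * c.out⁻¹)) := by
      intro γ hγ β
      simp only [mul_assoc, (term_inv G K (α * c.out⁻¹)) γ hγ]
    have e := hinv.sum_rmul c.out
    simp only [mul_inv_cancel_right] at e
    have h3 : slashHom c.out ((G * K) (α * c.out⁻¹)) =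
        ∑ᶠ b : Cosets Γ, slashHom c.out (term G K (α * c.out⁻¹) b.out) :=
      map_finsum _ (term_fin G K (α * c.out⁻¹))
    rw [h3, mul_finsum', e]
    · congr 1
      ext1 b
      simp only [d, term, map_mul, slashHom_slashHom, mul_inv_rev, inv_inv, mul_assoc,
        inv_mul_cancel_left, inv_mul_cancel, mul_one]
    · exact G.fin.subset fun q hq h ↦ hq (by simp [term, h])
  have hd : Function.HasFiniteSupport fun p : Cosets Γ × Cosets Γ ↦ d p.1 p.2 := by
    refine ((F.fin.prod G.fin).image fun p ↦ (rmul p.1.out p.2, p.1)).subset fun p hp ↦ ?_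
    refine ⟨(p.2, coset Γ (p.1.out * p.2.out⁻¹)), ⟨fun h ↦ hp ?_, fun h ↦ hp ?_⟩, ?_⟩
    · simp [d, h]
    · rw [G.left.out_coset] at h
      simp [d, h]
    · simp [rmul_coset, coset_out]
  rw [h1, h2, ← finsum_curry _ hd, ← finsum_comp_equiv (Equiv.prodComm _ _), finsum_curry]
  · rfl
  · exact hd.preimage (Equiv.injective _).injOn

instance : Ring (HeckeAlg Γ) where
  mul_assoc := HeckeAlg.mul_assoc
  one_mul := HeckeAlg.one_mul
  mul_one := HeckeAlg.mul_one
  left_distrib F G K := ext fun α ↦ by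
    refine Eq.trans ?_ (finsum_add_distrib (term_fin F G α) (term_fin F K α))
    simp only [mul_apply, term, add_apply, map_add, mul_add]
  right_distrib F G K := ext fun α ↦ by
    refine Eq.trans ?_ (finsum_add_distrib (term_fin F K α) (term_fin G K α))
    simp only [mul_apply, term, add_apply, add_mul]
  zero_mul F := ext fun α ↦ by simp [mul_apply, zero_apply]
  mul_zero F := ext fun α ↦ by simp [mul_apply, zero_apply]
  neg_add_cancel := neg_add_cancel
  zsmul := zsmulRec

instance : Algebra ℂ (HeckeAlg Γ) := Algebra.ofModule
  (fun c F G ↦ ext fun α ↦ by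
    rw [smul_apply]
    refine Eq.trans ?_ (smul_finsum' c (term_fin F G α)).symm
    exact finsum_congr fun q ↦ Algebra.smul_mul_assoc c (F q.out) _)
  (fun c F G ↦ ext fun α ↦ by
    rw [smul_apply]
    refine Eq.trans ?_ (smul_finsum' c (term_fin F G α)).symm
    refine finsum_congr fun q ↦ ?_
    rw [term, smul_apply, map_smul]
    exact Algebra.mul_smul_comm c (F q.out) _)

/-- The embedding of `M_k(Γ)` in `A(Γ)`: the modular form `f` for `Γ` becomes the map with the value
`f` on `Γ` and `0` elsewhere. -/
def ofForm (hΓ : IsCongruenceSubgroup Γ) {k : ℤ} (f : ModularForm (Γ.map (mapGL ℝ)) k) :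
    HeckeAlg Γ :=
  ofInvariant Γ
    (DirectSum.of (fun k ↦ formSpace k) k
      ⟨f, hΓ.imp fun _ h ↦ ⟨h.1, restrictMF (Subgroup.map_mono h.2) f, rfl⟩⟩)
    (fun γ hγ ↦ by
      rw [slashHom_of]
      congr 1
      exact Subtype.ext ((slash_ofSL k f γ).trans
        (f.slash_action_eq' _ (Subgroup.mem_map_of_mem _ hγ))))

theorem map_mapGL_le (Γ : Subgroup SL(2, ℤ)) : Γ.map (mapGL ℝ) ≤ 𝒮ℒ := by
  rintro _ ⟨γ, -, rfl⟩
  exact ⟨γ, rfl⟩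

/-- The modular form `ω₄ = -E₄ / 72`. -/
def omega4Form (Γ : Subgroup SL(2, ℤ)) : ModularForm (Γ.map (mapGL ℝ)) 4 :=
  (-1 / 72 : ℂ) • restrictMF (map_mapGL_le Γ) ModularForm.E₄

/-- The elements of `M` all of whose homogeneous components are cusp forms. -/
def IsCuspidal (f : Forms) : Prop := ∀ k, ((f k : formSpace k) : ℍ → ℂ) ∈ cuspSpace k

theorem IsCuspidal.zero : IsCuspidal 0 := fun k ↦ (cuspSpace k).zero_mem

theorem IsCuspidal.add {f g : Forms} (hf : IsCuspidal f) (hg : IsCuspidal g) :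
    IsCuspidal (f + g) := fun k ↦ (cuspSpace k).add_mem (hf k) (hg k)

theorem IsCuspidal.mul {f : Forms} (hf : IsCuspidal f) (g : Forms) : IsCuspidal (f * g) := by
  classical
  intro k
  rw [DirectSum.coe_mul_apply]
  refine Submodule.sum_mem _ fun ij hij ↦ ?_
  rw [← (Finset.mem_filter.1 hij).2]
  exact mul_mem_cuspSpace (hf _) (g _).2

theorem IsCuspidal.mul' (f : Forms) {g : Forms} (hg : IsCuspidal g) : IsCuspidal (f * g) := by
  classical
  intro k
  rw [DirectSum.coe_mul_apply]
  refine Submodule.sum_mem _ fun ij hij ↦ ?_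
  rw [← (Finset.mem_filter.1 hij).2, add_comm, mul_comm]
  exact mul_mem_cuspSpace (hg _) (f _).2

theorem IsCuspidal.slash {f : Forms} (hf : IsCuspidal f) (α : GQ) : IsCuspidal (slashHom α f) :=
  fun k ↦ by
    rw [slashHom_apply]
    exact slash_mem_cuspSpace (hf k) α

/-- The cuspidal ideal `A⁰(Γ)`: the `F ∈ A(Γ)` with all `F_α` cuspidal. -/
def cuspidalIdeal (Γ : Subgroup SL(2, ℤ)) : TwoSidedIdeal (HeckeAlg Γ) :=
  TwoSidedIdeal.mk' {F : HeckeAlg Γ | ∀ α, IsCuspidal (F α)} (fun _ ↦ IsCuspidal.zero)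
    (fun hF hG α ↦ (hF α).add (hG α))
    (fun {F} hF α ↦ by
      intro k
      rw [neg_apply]
      exact (cuspSpace k).neg_mem (hF α k))
    (fun {F G} hG α ↦ by
      rw [mul_apply]
      exact finsum_induction _ IsCuspidal.zero (fun _ _ ↦ IsCuspidal.add)
        fun q ↦ IsCuspidal.mul' _ ((hG _).slash _))
    (fun {F G} hF α ↦ by
      rw [mul_apply]
      exact finsum_induction _ IsCuspidal.zero (fun _ _ ↦ IsCuspidal.add)
        fun q ↦ (hF _).mul _)

theorem mem_cuspidalIdeal {F : HeckeAlg Γ} : F ∈ cuspidalIdeal Γ ↔ ∀ α, IsCuspidal (F α) :=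
  TwoSidedIdeal.mem_mk' _ _ _ _ _ _ _

end HeckeAlg

end Hecke

section Operators

open UpperHalfPlane hiding I
open Derivative ModularForm

/-- The Ramanujan derivation `X = (1 / 2πi) d/dz - (1 / 12πi) (d/dz log Δ) · k / 2` in weight `k`;
`D` is `(1 / 2πi) d/dz`. -/
def ramanujan (k : ℤ) (f : ℍ → ℂ) : ℍ → ℂ := fun z ↦
  D f z - 1 / 6 * (D discriminant z / discriminant z) * ((k : ℂ) / 2 * f z)

/-- `μ_α = (1 / 12πi) d/dz log ((Δ | α) / Δ)`. -/
def mu (α : GQ) : ℍ → ℂ := fun z ↦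
  1 / 6 * (D (slash 12 discriminant α / discriminant) z / (slash 12 discriminant α z / discriminant z))

/-- `Xᵐ(μ_α)`, which has weight `2m + 2`. -/
def muIter (α : GQ) : ℕ → ℍ → ℂ
  | 0 => mu α
  | m + 1 => ramanujan (2 * m + 2) (muIter α m)

/-- The first Rankin-Cohen bracket `{f, g}₁ = (l/2) (Df) g - (k/2) f (Dg)` of `f`, `g` of weights
`k`, `l`. -/
def rankinCohen (k l : ℤ) (f g : ℍ → ℂ) : ℍ → ℂ := fun z ↦
  (l : ℂ) / 2 * D f z * g z - (k : ℂ) / 2 * f z * D g z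

/-- The Schwarzian derivative `{y; z} = (log y')'' - ((log y')')² / 2`. -/
def schwarzian (y : ℂ → ℂ) (z : ℂ) : ℂ :=
  deriv (logDeriv (deriv y)) z - 1 / 2 * logDeriv (deriv y) z ^ 2

end Operators

end ConnesMoscovici
end

noncomputable section

open scoped TensorProduct

namespace ConnesMoscovici

section Analysis

open UpperHalfPlane hiding I
open Matrix.SpecialLinearGroup CongruenceSubgroup
open Derivative ModularForm Complex Filter
open EisensteinSeries (E2)
open scoped MatrixGroups ModularForm Manifold Topology Real

/-! ### The behaviour of derivatives at `i∞` -/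

/-! Since `D Δ / Δ = E₂`, the operator `X` is the Serre derivative. It commutes with the slash
action of integral matrices, but for a general `α` there is a defect: `X(f|α) = X(f)|α + μ_α ·
Y(f|α)` (`ramanujan_slash`). Applied to the summands `F_β · (G_{αβ⁻¹}|β)` of a product in `A(Γ)`,
this defect is exactly the term `δ₁ ⊗ Y` of the coproduct of `X` (`ramanujanOp_term`). The cocycle
rule `μ_{αβ} = μ_α|β + μ_β` (`mu_mul`) makes `δ₁` a derivation. As `ad X` sends multiplication by
`Xⁿ(μ)` to multiplication by `Xⁿ⁺¹(μ)`, and all these multiplications commute, the relations of `H₁`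
hold; the product rule need only be checked on generators (`HopfAction.ofGenerators`).

The Schwarzian part rests on one quantity. Let `L_α` be the logarithmic derivative of `Δ|α`. Then `D
L_α - L_α²/12` is the weight `4` slash by `α` of the same expression for `α = 1`, because the terms
in `c/(cz+d)` cancel (`logDeltaSchwarzian_eq_slash`). At `α = 1` it is therefore a level one form of
weight `4`, hence `-E₄/12` by dimension and the value at `i∞`. Subtracting the identities for `α`
and `1` gives `X(μ_α) - μ_α²/2 = ω₄|α - ω₄` (`ramanujan_mu`), and commuting `F` with `ω₄` multiplies
`F_α` by just this difference. At `α = 1` the identity is Ramanujan's equation for `E₂`, which also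
yields the Schwarzian of a primitive of `η⁴`.

The cochain `F` is a cocycle by direct expansion, and already `B₀ F = 0`. In `χ(F)` the term `δ₁Y ⊗
Y` turns `X(G)|β` into `X(G|β)`, which leaves a Rankin–Cohen bracket in each summand
(`chi_fundamental_apply`).

Modularity and cuspidality reduce to growth at `i∞`: Cauchy's estimate controls `D f`, and `E₂` has
a finite limit. -/

theorem norm_D_le {f : ℍ → ℂ} (hf : MDiff f) {A M : ℝ} (h : ∀ z : ℍ, A ≤ z.im → ‖f z‖ ≤ M) (z : ℍ)
    (hz : |A| + 2 ≤ z.im) : ‖D f z‖ ≤ M := by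
  have hA := le_abs_self A
  have hA' := abs_nonneg A
  have him : ∀ w : ℂ, w ∈ Metric.closedBall (z : ℂ) 1 → |A| + 1 ≤ w.im := fun w hw ↦ by
    have h1 : |(w - z).im| ≤ 1 := (abs_im_le_norm _).trans (by simpa [dist_eq_norm] using hw)
    have h2 := (abs_le.1 h1).1
    rw [sub_im, coe_im] at h2
    linarith
  have hdiff : DifferentiableOn ℂ (f ∘ ofComplex) (Metric.closedBall (z : ℂ) 1) :=
    (UpperHalfPlane.mdifferentiable_iff.1 hf).mono fun w hw ↦ by
      have := him w hw
      change 0 < w.im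
      linarith
  -- Cauchy's estimate on the unit circle about `z`. The margin `|A| + 2` keeps the closed disc
  -- inside the upper half-plane and above height `A`.
  have key := norm_deriv_le_of_forall_mem_sphere_norm_le (c := (z : ℂ)) (f := f ∘ ofComplex) (C := M)
    one_pos (hdiff.diffContOnCl_ball subset_rfl) fun w hw ↦ by
      have hw' := him w (Metric.sphere_subset_closedBall hw)
      have hpos : 0 < w.im := by linarith
      rw [Function.comp_apply, ofComplex_apply_of_im_pos hpos]
      exact h _ (by change A ≤ w.im; linarith)
  rw [div_one] at key
  -- The normalising factor only helps, so the same `M` bounds `D f`; this lets one estimate serve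
  -- both boundedness and vanishing.
  have hc : ‖(2 * π * I : ℂ)⁻¹‖ ≤ 1 := by
    rw [norm_inv]
    refine inv_le_one_of_one_le₀ ?_
    simp only [norm_mul, norm_I, mul_one, Complex.norm_ofNat, norm_real, Real.norm_eq_abs]
    rw [abs_of_pos Real.pi_pos]
    linarith [Real.pi_gt_three]
  rw [normalizedDerivOfComplex, norm_mul]
  exact (mul_le_of_le_one_left (norm_nonneg _) hc).trans key

theorem isBoundedAtImInfty_D {f : ℍ → ℂ} (hf : MDiff f) (h : IsBoundedAtImInfty f) :
    IsBoundedAtImInfty (D f) := by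
  obtain ⟨M, A, h⟩ := isBoundedAtImInfty_iff.1 h
  exact isBoundedAtImInfty_iff.2 ⟨M, |A| + 2, norm_D_le hf h⟩

theorem isZeroAtImInfty_D {f : ℍ → ℂ} (hf : MDiff f) (h : IsZeroAtImInfty f) :
    IsZeroAtImInfty (D f) := by
  refine isZeroAtImInfty_iff.2 fun ε hε ↦ ?_
  obtain ⟨A, h⟩ := isZeroAtImInfty_iff.1 h ε hε
  exact ⟨|A| + 2, norm_D_le hf h⟩

/-- The quotient `(f - c₀)/q` has the shifted power series in `q`, so it is bounded at `i∞`, while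
`q → 0`. -/
theorem tendsto_of_hasSum_qExpansion {f : ℍ → ℂ} {c : ℕ → ℂ}
    (hf : ∀ τ : ℍ, HasSum (fun m ↦ c m • Function.Periodic.qParam 1 τ ^ m) (f τ)) :
    Tendsto f atImInfty (𝓝 (c 0)) := by
  let g : ℍ → ℂ := fun τ ↦ (f τ - c 0) / Function.Periodic.qParam 1 τ
  have hq : ∀ τ : ℍ, Function.Periodic.qParam 1 τ ≠ 0 := fun τ ↦ Function.Periodic.qParam_ne_zero _
  have hg : IsBoundedAtImInfty g := by
    refine isBoundedAtImInfty_of_hasSum_qExpansion (c := fun m ↦ c (m + 1)) one_pos fun τ ↦ ?_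
    have h := (hasSum_nat_add_iff' 1).2 (hf τ)
    simp only [Finset.range_one, Finset.sum_singleton, pow_zero, smul_eq_mul, mul_one] at h
    refine (h.div_const (Function.Periodic.qParam 1 τ)).congr_fun fun m ↦ ?_
    rw [smul_eq_mul, pow_succ, ← mul_assoc, mul_div_cancel_right₀ _ (hq τ)]
  have hlim : Tendsto (fun τ : ℍ ↦ Function.Periodic.qParam 1 τ * g τ) atImInfty (𝓝 0) :=
    (qParam_tendsto_atImInfty one_pos).zero_mul_isBoundedUnder_le hg.isBoundedUnder_le
  refine (hlim.const_add (c 0)).congr' (Eventually.of_forall fun τ ↦ ?_) |>.trans_eq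
    (by rw [add_zero])
  simp only [g]
  rw [mul_div_cancel₀ _ (hq τ), add_sub_cancel]

theorem tendsto_E2_atImInfty : Tendsto E2 atImInfty (𝓝 1) :=
  tendsto_of_hasSum_qExpansion
    (c := fun m : ℕ ↦ (if m = 0 then 1 else -24 * ArithmeticFunction.sigma 1 m : ℂ)) fun τ ↦ by
    simpa only [Function.Periodic.qParam, ofReal_one, div_one] using
      EisensteinSeries.hasSum_qExpansion_E2 τ

theorem tendsto_E₄_atImInfty : Tendsto E₄ atImInfty (𝓝 1) := by
  have h := tendsto_of_hasSum_qExpansion (f := E₄)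
    (c := fun m ↦ (qExpansion 1 E₄).coeff m) fun τ ↦
      hasSum_qExpansion one_pos
        (SlashInvariantFormClass.periodic_comp_ofComplex E₄ one_mem_strictPeriods_SL)
        (ModularFormClass.holo E₄) (ModularFormClass.bdd_at_infty E₄) τ
  rwa [EisensteinSeries.E_qExpansion_coeff_zero (by norm_num : 3 ≤ 4) ⟨2, rfl⟩] at h

/-! ### The logarithmic derivative of `Δ` -/

theorem mdiff_discriminant : MDiff discriminant := CuspForm.discriminant.holo'

theorem discriminant_comp_eventuallyEq (z : ℍ) :
    discriminant ∘ ofComplex =ᶠ[𝓝 (z : ℂ)] fun w ↦ ModularForm.eta w ^ 24 := by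
  filter_upwards [isOpen_upperHalfPlaneSet.mem_nhds z.im_pos] with w hw
  rw [Function.comp_apply, ofComplex_apply_of_im_pos hw]
  rfl

/-- As `Δ = η²⁴`, this is `24` times the logarithmic derivative of `η`, which is `(2πi/24) E₂`. -/
theorem D_discriminant_div (z : ℍ) : D discriminant z / discriminant z = E2 z := by
  have hd := differentiableAt_eta_of_mem_upperHalfPlaneSet (z := (z : ℂ)) z.im_pos
  have h0 := eta_ne_zero (z := (z : ℂ)) z.im_pos
  have h := logDeriv_eta_eq_E2 z
  rw [logDeriv_apply, div_eq_iff h0] at h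
  rw [normalizedDerivOfComplex, (discriminant_comp_eventuallyEq z).deriv_eq, deriv_fun_pow hd, h,
    discriminant]
  have hpi : (π : ℂ) ≠ 0 := by exact_mod_cast Real.pi_ne_zero
  field_simp
  norm_num
  ring

theorem ramanujan_eq_serreDerivative (k : ℤ) (f : ℍ → ℂ) :
    ramanujan k f = serreDerivative k f := by
  ext z
  rw [ramanujan, D_discriminant_div, serreDerivative_apply]
  ring

theorem ramanujan_apply (k : ℤ) (f : ℍ → ℂ) (z : ℍ) :
    ramanujan k f z = D f z - k / 12 * E2 z * f z := by
  rw [ramanujan_eq_serreDerivative, serreDerivative_apply]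
  ring

theorem mdiff_ramanujan (k : ℤ) {f : ℍ → ℂ} (hf : MDiff f) : MDiff (ramanujan k f) := by
  rw [ramanujan_eq_serreDerivative]
  exact serreDerivative_mdifferentiable _ hf

theorem ramanujan_add (k : ℤ) {f g : ℍ → ℂ} (hf : MDiff f) (hg : MDiff g) :
    ramanujan k (f + g) = ramanujan k f + ramanujan k g := by
  simp only [ramanujan_eq_serreDerivative]
  exact serreDerivative_add _ _ _ hf hg

theorem ramanujan_smul (k : ℤ) (c : ℂ) {f : ℍ → ℂ} (hf : MDiff f) :
    ramanujan k (c • f) = c • ramanujan k f := by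
  simp only [ramanujan_eq_serreDerivative]
  exact serreDerivative_smul _ _ _ hf

theorem ramanujan_mul (k l : ℤ) {f g : ℍ → ℂ} (hf : MDiff f) (hg : MDiff g) :
    ramanujan (k + l) (f * g) = ramanujan k f * g + f * ramanujan l g := by
  simp only [ramanujan_eq_serreDerivative]
  push_cast
  exact serreDerivative_mul _ _ _ _ hf hg

theorem ramanujan_eq (k : ℤ) (f : ℍ → ℂ) :
    ramanujan k f = D f + (-(k / 12 : ℂ)) • (E2 * f) := by
  ext z
  simp only [ramanujan_apply, Pi.add_apply, Pi.smul_apply, Pi.mul_apply, smul_eq_mul]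
  ring

theorem isBoundedAtImInfty_ramanujan (k : ℤ) {f : ℍ → ℂ} (hf : MDiff f) (h : IsBoundedAtImInfty f) :
    IsBoundedAtImInfty (ramanujan k f) := by
  rw [ramanujan_eq]
  exact (isBoundedAtImInfty_D hf h).add
    ((EisensteinSeries.isBoundedAtImInfty_E2.mul h).const_smul_left _)

/-- This is why `X` preserves cusp forms: `D f` vanishes at `i∞` by the Cauchy estimate, and `E₂ f`
because `E₂` tends to `1`. -/
theorem isZeroAtImInfty_ramanujan (k : ℤ) {f : ℍ → ℂ} (hf : MDiff f) (h : IsZeroAtImInfty f) :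
    IsZeroAtImInfty (ramanujan k f) := by
  have h' : Tendsto (E2 * f) atImInfty (𝓝 0) := by
    simpa using! tendsto_E2_atImInfty.mul h
  rw [ramanujan_eq]
  exact (isZeroAtImInfty_D hf h).add (ZeroAtFilter.smul _ h')

/-! ### The slash operators and differentiation -/

/-- The logarithmic derivative `(1 / 2πi) c / (cz + d)` of the automorphy factor. -/
def logFactor (α : GQ) (z : ℍ) : ℂ := (2 * π * I)⁻¹ * ((toGLR α 1 0 : ℝ) / denom (toGLR α) z)

theorem mdiff_slash (k : ℤ) {f : ℍ → ℂ} (hf : MDiff f) (α : GQ) : MDiff (slash k f α) := by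
  rw [slash_eq]
  exact (hf.slash k _).const_smul _

theorem D_slash (k : ℤ) {f : ℍ → ℂ} (hf : MDiff f) (α : GQ) (z : ℍ) :
    D (slash k f α) z = slash (k + 2) (D f) α z - k * logFactor α z * slash k f α z := by
  have hdet : 0 < (toGLR α).val.det := rdet_pos α
  have hpos := rdet_pos α
  -- The slash operator used here is `det^{1-k/2}` times Mathlib's. Passing from weight `k` to `k +
  -- 2` divides this factor by `det`, which is the determinant appearing in the chain rule.
  have h1 : ((rdet α ^ (1 - (k : ℝ) / 2) : ℝ) : ℂ) * (rdet α : ℂ)⁻¹ =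
      ((rdet α ^ (1 - ((k + 2 : ℤ) : ℝ) / 2) : ℝ) : ℂ) := by
    rw [← ofReal_inv, ← ofReal_mul, ← Real.rpow_neg_one (rdet α), ← Real.rpow_add hpos]
    congr 2
    push_cast
    ring
  rw [slash_eq, normalizedDerivOfComplex_smul _ _ (hf.slash k _), slash_eq, ← h1,
    normalizedDerivOfComplex_slash hf hdet]
  simp only [Pi.smul_apply, smul_eq_mul, logFactor]
  rw [show (toGLR α).val.det = rdet α from rfl]
  ring

/-- This Riccati equation is what makes the quadratic terms cancel in `logDeltaSchwarzian_eq_slash`.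
-/
theorem D_logFactor (α : GQ) (z : ℍ) : D (logFactor α) z = -logFactor α z ^ 2 := by
  have h0 := denom_ne_zero (toGLR α) z
  have h := (hasDerivAt_denom_zpow (toGLR α) (-1) z).const_mul
    ((2 * π * I)⁻¹ * ((toGLR α 1 0 : ℝ) : ℂ))
  have he : logFactor α ∘ ofComplex =ᶠ[𝓝 (z : ℂ)]
      fun w ↦ (2 * π * I)⁻¹ * ((toGLR α 1 0 : ℝ) : ℂ) * denom (toGLR α) w ^ (-1 : ℤ) := by
    filter_upwards [isOpen_upperHalfPlaneSet.mem_nhds z.im_pos] with w hw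
    rw [Function.comp_apply, ofComplex_apply_of_im_pos hw, logFactor, zpow_neg_one]
    simp only [div_eq_mul_inv, mul_assoc]
  rw [normalizedDerivOfComplex, he.deriv_eq, h.deriv, logFactor]
  rw [show (-1 - 1 : ℤ) = -2 by norm_num, zpow_neg]
  push_cast
  have : denom (toGLR α) z ^ (2 : ℤ) = denom (toGLR α) z ^ 2 := by norm_cast
  rw [this]
  field

theorem mdiff_logFactor (α : GQ) : MDiff (logFactor α) := by
  have h : logFactor α = ((2 * π * I)⁻¹ * ((toGLR α 1 0 : ℝ) : ℂ)) •
      fun z : ℍ ↦ (denom (toGLR α) z)⁻¹ := by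
    ext z
    simp only [logFactor, Pi.smul_apply, smul_eq_mul]
    ring
  rw [h]
  exact (mdifferentiable_inv_denom _).const_smul _

/-! ### Logarithmic derivatives of `Δ | α` and the cocycle `μ_α`. -/

theorem slash_discriminant_ne_zero (α : GQ) (z : ℍ) : slash 12 discriminant α z ≠ 0 := by
  refine mul_ne_zero (mul_ne_zero ?_ (discriminant_ne_zero _)) (zpow_ne_zero _ (denom_ne_zero _ _))
  exact_mod_cast (Real.rpow_pos_of_pos (rdet_pos α) _).ne'

/-- The logarithmic derivative of `Δ | α`. -/
def logDelta (α : GQ) (z : ℍ) : ℂ := D (slash 12 discriminant α) z / slash 12 discriminant α z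

theorem logDelta_one : logDelta 1 = E2 := by
  ext z
  rw [logDelta, slash_one', D_discriminant_div]

theorem logDelta_mul_slash (α : GQ) :
    logDelta α * slash 12 discriminant α = D (slash 12 discriminant α) :=
  funext fun z ↦ div_mul_cancel₀ _ (slash_discriminant_ne_zero α z)

/-- Differentiate `(Δ|α)|β` logarithmically: the derivative of `Δ|α` is `L_α · (Δ|α)`, whose slash
of weight `14 = 2 + 12` factors, and the weight `12` produces the correction. -/
theorem logDelta_mul (α β : GQ) (z : ℍ) :
    logDelta (α * β) z = slash 2 (logDelta α) β z - 12 * logFactor β z := by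
  have h := D_slash 12 (mdiff_slash 12 mdiff_discriminant α) β z
  rw [← logDelta_mul_slash, slash_slash, add_comm 12 2, slash_mul, Pi.mul_apply, slash_slash] at h
  rw [logDelta, h, div_eq_iff (slash_discriminant_ne_zero _ z)]
  push_cast
  ring

theorem logDelta_eq (α : GQ) (z : ℍ) :
    logDelta α z = slash 2 E2 α z - 12 * logFactor α z := by
  simpa [logDelta_one] using logDelta_mul 1 α z

theorem mdiff_logDelta (α : GQ) : MDiff (logDelta α) := by
  have h : logDelta α = slash 2 E2 α + (-12 : ℂ) • logFactor α := by
    ext z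
    rw [logDelta_eq, Pi.add_apply, Pi.smul_apply, smul_eq_mul]
    ring
  rw [h]
  exact (mdiff_slash 2 E2_mdifferentiable α).add ((mdiff_logFactor α).const_smul _)

theorem D_discriminant_quotient (α : GQ) (z : ℍ) :
    D (slash 12 discriminant α / discriminant) z / (slash 12 discriminant α z / discriminant z) =
      logDelta α z - E2 z := by
  have h1 := UpperHalfPlane.mdifferentiableAt_iff.1 (mdiff_slash 12 mdiff_discriminant α z)
  have h2 := UpperHalfPlane.mdifferentiableAt_iff.1 (mdiff_discriminant z)
  have h3 := slash_discriminant_ne_zero α z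
  have h4 := discriminant_ne_zero z
  rw [logDelta, ← D_discriminant_div]
  simp only [normalizedDerivOfComplex]
  rw [show (slash 12 discriminant α / discriminant) ∘ ofComplex =
    (slash 12 discriminant α ∘ ofComplex) / (discriminant ∘ ofComplex) from rfl,
    deriv_div h1 h2 (by simpa using h4)]
  simp only [Function.comp_apply, ofComplex_apply]
  field

theorem mu_apply (α : GQ) (z : ℍ) : mu α z = 1 / 6 * (logDelta α z - E2 z) := by
  rw [mu, D_discriminant_quotient]

theorem mu_eq (α : GQ) : mu α = (1 / 6 : ℂ) • (logDelta α - E2) := funext (mu_apply α)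

theorem mdiff_mu (α : GQ) : MDiff (mu α) := by
  rw [mu_eq]
  exact ((mdiff_logDelta α).sub E2_mdifferentiable).const_smul _

/-- The defect has two sources: `-k · logFactor` from `D`, and `(k/12)(E₂|α - E₂)` from the
connection term. By `logDelta_eq` they add up to `(k/12)(L_α - E₂) = (k/2) μ_α`. -/
theorem ramanujan_slash (k : ℤ) {f : ℍ → ℂ} (hf : MDiff f) (α : GQ) :
    ramanujan k (slash k f α) =
      slash (k + 2) (ramanujan k f) α + mu α * ((k / 2 : ℂ) • slash k f α) := by
  ext z
  have h : slash (k + 2) (ramanujan k f) α z =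
      slash (k + 2) (D f) α z - k / 12 * (slash 2 E2 α z * slash k f α z) := by
    rw [ramanujan_eq, slash_add, slash_smul, add_comm k 2, slash_mul]
    simp only [Pi.add_apply, Pi.smul_apply, Pi.mul_apply, smul_eq_mul]
    ring
  simp only [Pi.add_apply, Pi.mul_apply, Pi.smul_apply, smul_eq_mul]
  rw [h, ramanujan_apply, D_slash k hf, mu_apply, logDelta_eq]
  ring

/-- The automorphy term of `β` occurs both in `L_{αβ}` and in `L_β`, and cancels. -/
theorem mu_mul (α β : GQ) : mu (α * β) = slash 2 (mu α) β + mu β := by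
  ext z
  rw [mu_eq α, slash_smul, sub_eq_add_neg, ← neg_one_smul ℂ E2, slash_add, slash_smul]
  simp only [Pi.add_apply, Pi.smul_apply, smul_eq_mul]
  rw [mu_apply, mu_apply, logDelta_mul, logDelta_eq β]
  ring

theorem slash_discriminant_ofSL (γ : SL(2, ℤ)) : slash 12 discriminant (ofSL γ) = discriminant := by
  rw [slash_ofSL]
  exact CuspForm.discriminant.slash_action_eq' _ ⟨γ, rfl⟩

theorem logDelta_ofSL (γ : SL(2, ℤ)) : logDelta (ofSL γ) = E2 := by
  ext z
  rw [logDelta, slash_discriminant_ofSL, D_discriminant_div]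

/-- Because `Δ` has level one. Consequently `μ_α` depends only on the coset of `α`, and `X` commutes
with integral slash operators. -/
theorem mu_ofSL (γ : SL(2, ℤ)) : mu (ofSL γ) = 0 := by
  rw [mu_eq, logDelta_ofSL, sub_self, smul_zero]

theorem mu_ofSL_mul (γ : SL(2, ℤ)) (α : GQ) : mu (ofSL γ * α) = mu α := by
  rw [mu_mul, mu_ofSL]
  ext z
  simp [slash]

theorem mu_mul_ofSL (α : GQ) (γ : SL(2, ℤ)) : mu (α * ofSL γ) = slash 2 (mu α) (ofSL γ) := by
  rw [mu_mul, mu_ofSL, add_zero]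

end Analysis

section Modularity

open UpperHalfPlane hiding I
open Matrix.SpecialLinearGroup CongruenceSubgroup
open Derivative ModularForm Complex Filter
open EisensteinSeries (E2)
open scoped MatrixGroups ModularForm Manifold Topology Real Pointwise

/-! ### Modularity of `X(f)` and of `μ_α` -/

variable {Γ : Subgroup SL(2, ℤ)} {k : ℤ}

theorem isBoundedAtImInfty_slash [Γ.FiniteIndex] (f : ModularForm (Γ.map (mapGL ℝ)) k)
    (γ : SL(2, ℤ)) : IsBoundedAtImInfty (slash k f (ofSL γ)) := by
  rw [slash_ofSL]
  refine f.bdd_at_cusps' (c := mapGL ℝ γ • OnePoint.infty) ?_ _ rfl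
  rw [Subgroup.IsArithmetic.isCusp_iff_isCusp_SL2Z, isCusp_SL2Z_iff']
  exact ⟨γ, rfl⟩

theorem isZeroAtImInfty_slash [Γ.FiniteIndex] (f : CuspForm (Γ.map (mapGL ℝ)) k)
    (γ : SL(2, ℤ)) : IsZeroAtImInfty (slash k f (ofSL γ)) := by
  rw [slash_ofSL]
  refine f.zero_at_cusps' (c := mapGL ℝ γ • OnePoint.infty) ?_ _ rfl
  rw [Subgroup.IsArithmetic.isCusp_iff_isCusp_SL2Z, isCusp_SL2Z_iff']
  exact ⟨γ, rfl⟩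

/-- A holomorphic function that is invariant under `Γ` and bounded at all cusps, as a modular form. -/
def mkModularForm [Γ.FiniteIndex] (f : ℍ → ℂ) (hf : MDiff f)
    (hinv : ∀ γ ∈ Γ, slash k f (ofSL γ) = f)
    (hb : ∀ γ : SL(2, ℤ), IsBoundedAtImInfty (slash k f (ofSL γ))) :
    ModularForm (Γ.map (mapGL ℝ)) k where
  toFun := f
  slash_action_eq' := by
    rintro _ ⟨γ, hγ, rfl⟩
    rw [← slash_ofSL]
    exact hinv γ hγ
  holo' := hf
  bdd_at_cusps' := fun {c} hc ↦ by
    rw [Subgroup.IsArithmetic.isCusp_iff_isCusp_SL2Z] at hc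
    rw [OnePoint.isBoundedAt_iff_forall_SL2Z hc]
    intro γ _
    have := hb γ
    rwa [slash_ofSL] at this

/-- A holomorphic function that is invariant under `Γ` and vanishes at all cusps, as a cusp form. -/
def mkCuspForm [Γ.FiniteIndex] (f : ℍ → ℂ) (hf : MDiff f)
    (hinv : ∀ γ ∈ Γ, slash k f (ofSL γ) = f)
    (hb : ∀ γ : SL(2, ℤ), IsZeroAtImInfty (slash k f (ofSL γ))) :
    CuspForm (Γ.map (mapGL ℝ)) k where
  toFun := f
  slash_action_eq' := by
    rintro _ ⟨γ, hγ, rfl⟩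
    rw [← slash_ofSL]
    exact hinv γ hγ
  holo' := hf
  zero_at_cusps' := fun {c} hc ↦ by
    rw [Subgroup.IsArithmetic.isCusp_iff_isCusp_SL2Z] at hc
    rw [OnePoint.isZeroAt_iff_forall_SL2Z hc]
    intro γ _
    have := hb γ
    rwa [slash_ofSL] at this

theorem ramanujan_slash_ofSL (k : ℤ) {f : ℍ → ℂ} (hf : MDiff f) (γ : SL(2, ℤ)) :
    slash (k + 2) (ramanujan k f) (ofSL γ) = ramanujan k (slash k f (ofSL γ)) := by
  rw [ramanujan_slash k hf, mu_ofSL, zero_mul, add_zero]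

theorem slash_eq_self_of_mem (f : ModularForm (Γ.map (mapGL ℝ)) k) {γ : SL(2, ℤ)} (hγ : γ ∈ Γ) :
    slash k f (ofSL γ) = f := by
  rw [slash_ofSL]
  exact f.slash_action_eq' _ (Subgroup.mem_map_of_mem _ hγ)

/-- The Ramanujan derivative of a modular form. -/
def ramanujanForm [Γ.FiniteIndex] (f : ModularForm (Γ.map (mapGL ℝ)) k) :
    ModularForm (Γ.map (mapGL ℝ)) (k + 2) :=
  mkModularForm (ramanujan k f) (mdiff_ramanujan k (ModularFormClass.holo f))
    (fun γ hγ ↦ by rw [ramanujan_slash_ofSL k (ModularFormClass.holo f), slash_eq_self_of_mem f hγ])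
    (fun γ ↦ by
      rw [ramanujan_slash_ofSL k (ModularFormClass.holo f)]
      exact isBoundedAtImInfty_ramanujan k (mdiff_slash k (ModularFormClass.holo f) _)
        (isBoundedAtImInfty_slash f γ))

theorem finiteIndex_Gamma {N : ℕ} (hN : N ≠ 0) : (CongruenceSubgroup.Gamma N).FiniteIndex :=
  have : NeZero N := ⟨hN⟩
  inferInstance

theorem mdiff_of_mem_formSpace {f : ℍ → ℂ} (hf : f ∈ formSpace k) : MDiff f := by
  obtain ⟨N, -, f, rfl⟩ := hf
  exact f.holo'

theorem ramanujan_mem_formSpace {f : ℍ → ℂ} (hf : f ∈ formSpace k) :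
    ramanujan k f ∈ formSpace (k + 2) := by
  obtain ⟨N, hN, f, rfl⟩ := hf
  have := finiteIndex_Gamma hN
  exact ⟨N, hN, ramanujanForm f, rfl⟩

theorem ramanujan_mem_cuspSpace {f : ℍ → ℂ} (hf : f ∈ cuspSpace k) :
    ramanujan k f ∈ cuspSpace (k + 2) := by
  obtain ⟨N, hN, f, rfl⟩ := hf
  have := finiteIndex_Gamma hN
  refine ⟨N, hN, mkCuspForm (ramanujan k f) (mdiff_ramanujan k (CuspFormClass.holo f))
    (fun γ hγ ↦ ?_) (fun γ ↦ ?_), rfl⟩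
  · have h : slash k f (ofSL γ) = f := by
      rw [slash_ofSL]
      exact f.slash_action_eq' _ (Subgroup.mem_map_of_mem _ hγ)
    rw [ramanujan_slash_ofSL k (CuspFormClass.holo f), h]
  · rw [ramanujan_slash_ofSL k (CuspFormClass.holo f)]
    exact isZeroAtImInfty_ramanujan k (mdiff_slash k (CuspFormClass.holo f) _)
      (isZeroAtImInfty_slash f γ)

/-- For upper triangular `α` the automorphy term disappears, so `μ_α = (E₂|α - E₂)/6`, and such an
`α` preserves boundedness at `i∞`. -/
theorem isBoundedAtImInfty_mu_of_eq_zero {α : GQ} (h : toGLR α 1 0 = 0) :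
    IsBoundedAtImInfty (mu α) := by
  have h1 : mu α = (1 / 6 : ℂ) • (slash 2 E2 α + (-1 : ℂ) • E2) := by
    ext z
    simp only [mu_apply, logDelta_eq, logFactor, h, Pi.add_apply, Pi.smul_apply, smul_eq_mul]
    push_cast
    ring
  rw [h1, slash_eq]
  refine BoundedAtFilter.smul _ (BoundedAtFilter.add (BoundedAtFilter.smul _ ?_)
    (BoundedAtFilter.smul _ EisensteinSeries.isBoundedAtImInfty_E2))
  exact IsBoundedAtImInfty.slash _ h EisensteinSeries.isBoundedAtImInfty_E2

theorem ofSL_coe (γ : SL(2, ℤ)) : ((ofSL γ : GQ) : GL (Fin 2) ℚ) = mapGL ℚ γ := by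
  ext i j
  simp [ofSL]

/-- The point `α∞` is rational, so some integral `γ` sends `∞` to it; then `γ⁻¹α` fixes `∞`. -/
theorem exists_ofSL_mul_upperTriangular (α : GQ) :
    ∃ (γ : SL(2, ℤ)) (β : GQ), α = ofSL γ * β ∧ toGLR β 1 0 = 0 := by
  obtain ⟨γ, hγ⟩ := OnePoint.exists_mem_SL2 ℤ ((α : GL (Fin 2) ℚ) • (OnePoint.infty : OnePoint ℚ))
  refine ⟨γ, (ofSL γ)⁻¹ * α, by group, ?_⟩
  have h : (((ofSL γ)⁻¹ * α : GQ) : GL (Fin 2) ℚ) • (OnePoint.infty : OnePoint ℚ) =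
      OnePoint.infty := by
    rw [Subgroup.coe_mul, mul_smul, ← hγ, Subgroup.coe_inv, ofSL_coe, inv_smul_smul]
  rw [OnePoint.smul_infty_eq_self_iff] at h
  exact congrArg (Rat.castHom ℝ) h |>.trans (map_zero _)

theorem isBoundedAtImInfty_mu (α : GQ) : IsBoundedAtImInfty (mu α) := by
  obtain ⟨γ, β, rfl, hβ⟩ := exists_ofSL_mul_upperTriangular α
  rw [mu_ofSL_mul]
  exact isBoundedAtImInfty_mu_of_eq_zero hβ

theorem toGLR_injective : Function.Injective toGLR := by
  intro α β h
  refine Subtype.ext (Units.ext (Matrix.ext fun i j ↦ ?_))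
  have := congrFun (congrFun (congrArg (fun g : GL (Fin 2) ℝ ↦ g.val) h) i) j
  exact (Rat.castHom ℝ).injective this

/-- Choose `M` such that every `γ ∈ Γ(M)` satisfies `αγ = γ'α` with `γ'` integral. Then `μ_α|γ =
μ_{αγ} = μ_{γ'α} = μ_α`. At the other cusps `μ_α|γ = μ_{αγ}` is again some `μ`, hence bounded. -/
theorem mu_mem_formSpace (α : GQ) : mu α ∈ formSpace 2 := by
  obtain ⟨M, hM, h⟩ := exists_level α one_ne_zero
  have := finiteIndex_Gamma hM
  refine ⟨M, hM, mkModularForm (mu α) (mdiff_mu α) (fun γ hγ ↦ ?_) (fun γ ↦ ?_), rfl⟩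
  · have h1 := h (Subgroup.mem_map_of_mem (mapGL ℝ) hγ)
    rw [Subgroup.mem_pointwise_smul_iff_inv_smul_mem, ← ConjAct.toConjAct_inv, inv_inv,
      ConjAct.toConjAct_smul] at h1
    obtain ⟨γ', -, h2⟩ := h1
    have h3 : ofSL γ' * α = α * ofSL γ := toGLR_injective (by
      rw [map_mul, map_mul, toGLR_ofSL, toGLR_ofSL, h2, inv_mul_cancel_right])
    rw [← mu_mul_ofSL, ← h3, mu_ofSL_mul]
  · rw [← mu_mul_ofSL]
    exact isBoundedAtImInfty_mu _

/-! ### Ramanujan's differential equation for `E₂` -/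

/-- The quantity `D(L) - L² / 12`, for `L` the logarithmic derivative of `Δ | α`. -/
def logDeltaSchwarzian (α : GQ) (z : ℍ) : ℂ := D (logDelta α) z - 1 / 12 * logDelta α z ^ 2

theorem logDeltaSchwarzian_one : logDeltaSchwarzian 1 = D E2 + (-(1 / 12) : ℂ) • (E2 * E2) := by
  ext z
  simp only [logDeltaSchwarzian, logDelta_one, Pi.add_apply, Pi.smul_apply, Pi.mul_apply,
    smul_eq_mul]
  ring

/-- Put `L = E₂|α - 12ℓ` with `ℓ` the automorphy term. Both `D L` and `L²/12` contain `-2ℓ · (E₂|α)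
+ 12ℓ²`, so only the slash of `D E₂ - E₂²/12` survives. -/
theorem logDeltaSchwarzian_eq_slash (α : GQ) :
    logDeltaSchwarzian α = slash 4 (logDeltaSchwarzian 1) α := by
  ext z
  have hE : slash 4 (logDeltaSchwarzian 1) α z =
      slash (2 + 2) (D E2) α z - 1 / 12 * (slash 2 E2 α z * slash 2 E2 α z) := by
    rw [logDeltaSchwarzian_one, show (4 : ℤ) = 2 + 2 by norm_num, slash_add, slash_smul, slash_mul]
    simp only [Pi.add_apply, Pi.smul_apply, Pi.mul_apply, smul_eq_mul]
    ring
  have hL : logDelta α = slash 2 E2 α + (-12 : ℂ) • logFactor α := by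
    ext z
    rw [logDelta_eq, Pi.add_apply, Pi.smul_apply, smul_eq_mul]
    ring
  have hD : D (logDelta α) z = slash (2 + 2) (D E2) α z - 2 * logFactor α z * slash 2 E2 α z
      + 12 * logFactor α z ^ 2 := by
    rw [hL, normalizedDerivOfComplex_add _ _ (mdiff_slash 2 E2_mdifferentiable α)
      ((mdiff_logFactor α).const_smul _), normalizedDerivOfComplex_smul _ _ (mdiff_logFactor α)]
    simp only [Pi.add_apply, Pi.smul_apply, smul_eq_mul]
    rw [D_logFactor, D_slash 2 E2_mdifferentiable]
    push_cast
    ring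
  rw [hE, logDeltaSchwarzian, hD, logDelta_eq]
  ring

theorem slash_logDeltaSchwarzian_ofSL (γ : SL(2, ℤ)) :
    slash 4 (logDeltaSchwarzian 1) (ofSL γ) = logDeltaSchwarzian 1 := by
  rw [← logDeltaSchwarzian_eq_slash]
  ext z
  rw [logDeltaSchwarzian, logDelta_ofSL, logDeltaSchwarzian, logDelta_one]

theorem tendsto_logDeltaSchwarzian : Tendsto (logDeltaSchwarzian 1) atImInfty (𝓝 (-(1 / 12))) := by
  have h1 : Tendsto (D E2) atImInfty (𝓝 0) := by
    have hc : MDiff (fun _ : ℍ ↦ (1 : ℂ)) := mdifferentiable_const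
    -- Removing the constant term makes the Cauchy estimate give decay of `D E₂`, not just
    -- boundedness.
    have h : IsZeroAtImInfty (E2 - fun _ ↦ (1 : ℂ)) := by
      simpa [IsZeroAtImInfty, ZeroAtFilter] using! tendsto_E2_atImInfty.sub_const 1
    have h2 := isZeroAtImInfty_D (E2_mdifferentiable.sub hc) h
    rwa [normalizedDerivOfComplex_sub _ _ E2_mdifferentiable hc, normalizedDerivOfComplex_const,
      sub_zero] at h2
  rw [logDeltaSchwarzian_one]
  simpa using! h1.add ((tendsto_E2_atImInfty.mul tendsto_E2_atImInfty).const_smul (-(1 / 12) : ℂ))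

theorem map_mapGL_top : (⊤ : Subgroup SL(2, ℤ)).map (mapGL ℝ) = 𝒮ℒ :=
  (MonoidHom.range_eq_map _).symm

/-- Level one forms of weight `4` are the multiples of `E₄`. The limit `-1/12` at `i∞`, where `E₄`
tends to `1`, fixes the factor. -/
theorem logDeltaSchwarzian_one_eq (z : ℍ) : logDeltaSchwarzian 1 z = -(1 / 12) * E₄ z := by
  have hmd : MDiff (logDeltaSchwarzian 1) := by
    rw [logDeltaSchwarzian_one]
    exact (normalizedDerivOfComplex_mdifferentiable E2_mdifferentiable).add
      ((E2_mdifferentiable.mul E2_mdifferentiable).const_smul _)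
  have hb : IsBoundedAtImInfty (logDeltaSchwarzian 1) :=
    tendsto_logDeltaSchwarzian.isBigO_one ℝ
  let S : ModularForm 𝒮ℒ 4 := restrictMF map_mapGL_top.ge
    (mkModularForm (Γ := ⊤) (logDeltaSchwarzian 1) hmd
      (fun γ _ ↦ slash_logDeltaSchwarzian_ofSL γ)
      (fun γ ↦ by rwa [slash_logDeltaSchwarzian_ofSL]))
  obtain ⟨c, hc⟩ := (finrank_eq_one_iff_of_nonzero' E₄
    (EisensteinSeries.E_ne_zero (by norm_num) ⟨2, rfl⟩)).1
    (Module.rank_eq_one_iff_finrank_eq_one.1 levelOne_weight_four_rank_one) S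
  have hc' : ∀ z, c * E₄ z = logDeltaSchwarzian 1 z := fun z ↦ DFunLike.congr_fun hc z
  have h1 : Tendsto (logDeltaSchwarzian 1) atImInfty (𝓝 (c * 1)) :=
    (tendsto_E₄_atImInfty.const_mul c).congr hc'
  have h2 := tendsto_nhds_unique h1 tendsto_logDeltaSchwarzian
  rw [← hc', ← h2, mul_one]

/-- `X(μ_α) - μ_α² / 2 = ω₄ | α - ω₄`. -/
theorem ramanujan_mu (α : GQ) (z : ℍ) : ramanujan 2 (mu α) z - 1 / 2 * mu α z ^ 2 =
    -1 / 72 * (slash 4 E₄ α z - E₄ z) := by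
  have h1 := logDeltaSchwarzian_one_eq z
  have h2 : logDeltaSchwarzian α z = -(1 / 12) * slash 4 E₄ α z := by
    rw [logDeltaSchwarzian_eq_slash, show logDeltaSchwarzian 1 = (-(1 / 12) : ℂ) • ⇑E₄ from
      funext logDeltaSchwarzian_one_eq, slash_smul]
    rfl
  rw [logDeltaSchwarzian] at h1 h2
  rw [logDelta_one] at h1
  have hD : D (mu α) z = 1 / 6 * (D (logDelta α) z - D E2 z) := by
    rw [mu_eq, normalizedDerivOfComplex_smul _ _ ((mdiff_logDelta α).sub E2_mdifferentiable),
      normalizedDerivOfComplex_sub _ _ (mdiff_logDelta α) E2_mdifferentiable]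
    rfl
  rw [ramanujan_apply, hD, mu_apply]
  push_cast
  -- With `μ = (L_α - E₂)/6`, the mixed products `E₂ L_α` from `E₂ μ` and from `μ²` cancel. What
  -- remains is one sixth of the difference of the two Schwarzian identities.
  linear_combination (1 / 6) * h2 - (1 / 6) * h1

/-- The logarithmic derivative of `Z'` is four times that of `η`, namely `(2πi/6) E₂`. Ramanujan's
equation `D E₂ = (E₂² - E₄)/12` then cancels the squares of `E₂`. -/
theorem schwarzian_eq {Z : ℂ → ℂ}
    (hZ : ∀ z : ℂ, 0 < z.im → HasDerivAt Z (2 * π * I / 6 * ModularForm.eta z ^ 4) z) (z : ℍ) :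
    schwarzian Z z = (2 * π * I) ^ 2 * (-1 / 72 * E₄ z) := by
  have hpi : (π : ℂ) ≠ 0 := by exact_mod_cast Real.pi_ne_zero
  have hc : (2 * π * I / 6 : ℂ) ≠ 0 := by simp [hpi]
  have hU : ∀ w : ℍ, upperHalfPlaneSet ∈ 𝓝 (w : ℂ) := fun w ↦
    isOpen_upperHalfPlaneSet.mem_nhds w.im_pos
  have hlog : ∀ w : ℍ, logDeriv (deriv Z) w = 2 * π * I / 6 * E2 w := fun w ↦ by
    have he : deriv Z =ᶠ[𝓝 (w : ℂ)] fun u ↦ 2 * π * I / 6 * ModularForm.eta u ^ 4 := by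
      filter_upwards [hU w] with u hu
      exact (hZ u hu).deriv
    have hd := differentiableAt_eta_of_mem_upperHalfPlaneSet (z := (w : ℂ)) w.im_pos
    have h := logDeriv_eta_eq_E2 w
    rw [logDeriv_apply, he.deriv_eq, he.eq_of_nhds, ← logDeriv_apply (fun u : ℂ ↦ _) (w : ℂ),
      logDeriv_const_mul _ _ hc, logDeriv_fun_pow hd, h]
    push_cast
    ring
  have hlog' : logDeriv (deriv Z) =ᶠ[𝓝 (z : ℂ)] fun u ↦ 2 * π * I / 6 * (E2 ∘ ofComplex) u := by
    filter_upwards [hU z] with u hu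
    rw [Function.comp_apply, ofComplex_apply_of_im_pos hu]
    exact hlog ⟨u, hu⟩
  have hE := UpperHalfPlane.mdifferentiableAt_iff.1 (E2_mdifferentiable z)
  have h1 := logDeltaSchwarzian_one_eq z
  rw [logDeltaSchwarzian, logDelta_one, normalizedDerivOfComplex] at h1
  have h2 : deriv (E2 ∘ ofComplex) z = 2 * π * I * (1 / 12 * E2 z ^ 2 - (1 / 12) * E₄ z) := by
    have h2pi : (2 * π * I : ℂ) ≠ 0 := by simp [hpi]
    rw [← mul_right_inj' (inv_ne_zero h2pi), inv_mul_cancel_left₀ h2pi]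
    linear_combination h1
  rw [schwarzian, hlog'.deriv_eq, deriv_const_mul _ hE, hlog, h2]
  ring

end Modularity

section HopfActions

open Coalgebra HopfAlgebra H1

/-! ### Hopf actions of `H₁` from the actions of the generators -/

theorem comul_eq (h : H1) : comul (R := ℂ) h = comulHom h := rfl

theorem counit_eq (h : H1) : counit (R := ℂ) h = counitHom h := rfl

variable {A : Type*} [Ring A] [Algebra ℂ A]

/-- The bilinear operation `(a, b) ↦ ∑ h(a) k(b)` given by `∑ h ⊗ k`. -/
def actPair (act : H1 →ₐ[ℂ] Module.End ℂ A) (a b : A) : H1 ⊗[ℂ] H1 →ₗ[ℂ] A :=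
  LinearMap.mul' ℂ A ∘ₗ TensorProduct.map (act.toLinearMap.flip a) (act.toLinearMap.flip b)

theorem actPair_tmul (act : H1 →ₐ[ℂ] Module.End ℂ A) (a b : A) (h k : H1) :
    actPair act a b (h ⊗ₜ k) = act h a * act k b := by
  simp [actPair]

theorem actPair_mul_tmul (act : H1 →ₐ[ℂ] Module.End ℂ A) (a b : A) (t : H1 ⊗[ℂ] H1) (h k : H1) :
    actPair act a b (t * h ⊗ₜ k) = actPair act (act h a) (act k b) t := by
  induction t with
  | zero => simp
  | add s t hs ht => rw [add_mul, map_add, map_add, hs, ht]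
  | tmul p q => simp [actPair_tmul]

/-- This carries the product rule from `h` and `k` to `hk`: applying `h` after `k` becomes
multiplication by `Δh` on the left of `Δk`. -/
theorem act_actPair (act : H1 →ₐ[ℂ] Module.End ℂ A) {h : H1}
    (hh : ∀ a b, act h (a * b) = actPair act a b (comulHom h)) (a b : A) (t : H1 ⊗[ℂ] H1) :
    act h (actPair act a b t) = actPair act a b (comulHom h * t) := by
  induction t with
  | zero => simp
  | add s t hs ht => rw [mul_add, map_add, map_add, map_add, hs, ht]
  | tmul p q => rw [actPair_tmul, hh, actPair_mul_tmul]

/-- A representation of `H₁` on an algebra in which the generators satisfy the product rules is a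
Hopf action. -/
def HopfAction.ofGenerators (act : H1 →ₐ[ℂ] Module.End ℂ A)
    (hX : ∀ a b, act X (a * b) = act X a * b + a * act X b + act (δ 1) a * act Y b)
    (hY : ∀ a b, act Y (a * b) = act Y a * b + a * act Y b)
    (hδ : ∀ a b, act (δ 1) (a * b) = act (δ 1) a * b + a * act (δ 1) b)
    (hX1 : act X 1 = 0) (hY1 : act Y 1 = 0) (hδ1 : act (δ 1) 1 = 0) : HopfAction H1 A where
  act := act
  act_mul h a b := by
    change act h (a * b) = actPair act a b (comulHom h)
    induction h using H1.induction generalizing a b with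
    | hc c =>
      rw [AlgHom.commutes, AlgHom.commutes, Algebra.algebraMap_eq_smul_one,
        Algebra.algebraMap_eq_smul_one, Algebra.TensorProduct.one_def, map_smul, actPair_tmul]
      simp
    | hX => rw [hX, comulHom_X]; simp [actPair_tmul]
    | hY => rw [hY, comulHom_Y]; simp [actPair_tmul]
    | hδ => rw [hδ, comulHom_δ]; simp [actPair_tmul]
    | hadd h k hh hk => rw [map_add, map_add, map_add, LinearMap.add_apply, hh, hk]
    | hmul h k hh hk =>
      rw [map_mul act, map_mul comulHom, Module.End.mul_apply, hk, act_actPair act hh]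
  act_one h := by
    rw [counit_eq]
    induction h using H1.induction with
    | hc c => simp [Algebra.algebraMap_eq_smul_one]
    | hX => rw [hX1, counitHom_X, zero_smul]
    | hY => rw [hY1, counitHom_Y, zero_smul]
    | hδ => rw [hδ1, counitHom_δ, zero_smul]
    | hadd h k hh hk => rw [map_add, map_add, LinearMap.add_apply, hh, hk, add_smul]
    | hmul h k hh hk =>
      rw [map_mul act, map_mul counitHom, Module.End.mul_apply, hk, map_smul, hh, smul_smul, mul_comm]

/-! ### The transverse fundamental class -/

theorem twistedAntipode_X : twistedAntipode ν X = -X + δ 1 * Y := by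
  have : antipode ℂ X = -X + δ 1 * Y := antipodeLin_X
  simp [twistedAntipode, comul_eq, comulHom_X, ν, character_X, character_δ, this]

theorem twistedAntipode_Y : twistedAntipode ν Y = 1 - Y := by
  have : antipode ℂ Y = -Y := antipodeLin_Y
  simp [twistedAntipode, comul_eq, comulHom_Y, ν, character_Y, this, sub_eq_add_neg]

/-- Only `Y ⊗ δ₁` and `1 ⊗ δ₁Y` survive `ν` on the left factor; they give `-δ₁` and `Yδ₁ = δ₁ +
δ₁Y`. -/
theorem twistedAntipode_δY : twistedAntipode ν (δ 1 * Y) = δ 1 * Y := by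
  have h1 : antipode ℂ (δ 1) = -δ 1 := antipodeLin_δ
  have h2 : antipode ℂ (δ 1 * Y) = Y * δ 1 := by
    change antipodeLin (δ 1 * Y) = _
    rw [antipodeLin_mul, antipodeLin_Y, antipodeLin_δ, neg_mul_neg]
  have h3 : comulHom (δ 1 * Y) = (δ 1 * Y) ⊗ₜ 1 + δ 1 ⊗ₜ Y + Y ⊗ₜ δ 1 + 1 ⊗ₜ (δ 1 * Y) := by
    rw [map_mul, comulHom_δ, comulHom_Y]
    simp only [add_mul, mul_add, Algebra.TensorProduct.tmul_mul_tmul, one_mul, mul_one]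
    abel
  rw [twistedAntipode, LinearMap.comp_apply, LinearMap.comp_apply, comul_eq, h3]
  simp [ν, character_Y, character_δ, h1, h2, yδ']

/-- Already `B₀` vanishes: the terms `δ₁Y²` cancel, and `-XY - X + YX = 0` is the relation `[Y, X] =
X`. -/
theorem connesB_fundamental : connesB ν fundamental = 0 := by
  have : LinearMap.mul' ℂ H1 ((twistedAntipode ν).rTensor H1 fundamental) = 0 := by
    simp only [fundamental, map_sub, LinearMap.rTensor_tmul, LinearMap.mul'_apply,
      twistedAntipode_X, twistedAntipode_Y, twistedAntipode_δY]
    simp only [add_mul, sub_mul, neg_mul, one_mul, yx']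
    abel
  rw [connesB, LinearMap.comp_apply, LinearMap.comp_apply, this, map_zero]

/-- For primitive entries all terms would cancel. The term `δ₁ ⊗ Y` of `ΔX` leaves `-δ₁ ⊗ Y ⊗ Y - Y
⊗ δ₁ ⊗ Y`, which the mixed terms of `Δ(δ₁Y)` in the correction `δ₁Y ⊗ Y` compensate. -/
theorem hopfB2_fundamental : hopfB2 H1 fundamental = 0 := by
  simp only [fundamental, hopfB2, map_sub, LinearMap.sub_apply, LinearMap.add_apply,
    TensorProduct.mk_apply, LinearMap.comp_apply, LinearMap.rTensor_tmul, LinearMap.lTensor_tmul,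
    comul_eq, map_mul, comulHom_X, comulHom_Y, comulHom_δ, LinearMap.flip_apply,
    add_mul, mul_add, Algebra.TensorProduct.tmul_mul_tmul, one_mul, mul_one,
    TensorProduct.add_tmul, TensorProduct.tmul_add, map_add, LinearEquiv.coe_coe,
    TensorProduct.assoc_tmul]
  abel

theorem fundamental_mem_normalized2 : fundamental ∈ normalized2 H1 := by
  constructor <;> simp [fundamental, counit_eq, counitHom_X, counitHom_Y]

theorem fundamental_mem_HopfCyclicZ2 : (fundamental, (0 : ℂ)) ∈ HopfCyclicZ2 ν :=
  ⟨⟨fundamental_mem_normalized2, hopfB2_fundamental⟩, connesB_fundamental⟩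

theorem HopfAction.chi_fundamental (ρ : HopfAction H1 A) (a b : A) :
    ρ.chi fundamental a b = ρ.act X a * ρ.act Y b - ρ.act Y a * ρ.act X b
      - ρ.act (δ 1) (ρ.act Y a) * ρ.act Y b := by
  simp [fundamental, HopfAction.chi_tmul]

end HopfActions

section FormOperators

open UpperHalfPlane hiding I
open Matrix.SpecialLinearGroup CongruenceSubgroup
open Derivative ModularForm
open scoped MatrixGroups ModularForm DirectSum Manifold

/-! ### Operators on the algebra of modular forms -/

/-- A modular form of weight `k` as an element of the graded algebra. -/
abbrev single (k : ℤ) (f : formSpace k) : Forms := DirectSum.of (fun k ↦ formSpace k) k f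

/-- Weights such as `i + 2 + j` and `i + j + 2` index different types; this compares forms in them
through the underlying functions. -/
theorem single_congr {i j : ℤ} (h : i = j) {f : formSpace i} {g : formSpace j}
    (hfg : (f : ℍ → ℂ) = g) : single i f = single j g := by
  subst h
  rw [Subtype.ext hfg]

theorem single_mul_single {i j : ℤ} (f : formSpace i) (g : formSpace j) :
    single i f * single j g = single (i + j) ⟨f * g, mul_mem_formSpace f.2 g.2⟩ :=
  DirectSum.of_mul_of _ _

theorem single_mul_apply {i j n : ℤ} (h : i + j = n) (x : formSpace i) (f : Forms) :
    (((single i x * f) n : formSpace n) : ℍ → ℂ) = x * (f j : formSpace j) := by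
  subst h
  exact DirectSum.coe_of_mul_apply_add formSpace x f j

/-- The weight operator on `M`, multiplication by `k / 2` in weight `k`. -/
def weightOp : Forms →ₗ[ℂ] Forms :=
  DirectSum.toModule ℂ ℤ Forms fun k ↦
    DirectSum.lof ℂ ℤ (fun k ↦ formSpace k) k ∘ₗ (((k : ℂ) / 2) • LinearMap.id)

/-- The Ramanujan derivation in weight `k`. -/
def ramanujanLin (k : ℤ) : formSpace k →ₗ[ℂ] formSpace (k + 2) where
  toFun f := ⟨ramanujan k f, ramanujan_mem_formSpace f.2⟩
  map_add' f g := Subtype.ext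
    (ramanujan_add k (mdiff_of_mem_formSpace f.2) (mdiff_of_mem_formSpace g.2))
  map_smul' c f := Subtype.ext (ramanujan_smul k c (mdiff_of_mem_formSpace f.2))

/-- The Ramanujan derivation on `M`. -/
def ramanujanOp : Forms →ₗ[ℂ] Forms :=
  DirectSum.toModule ℂ ℤ Forms fun k ↦
    DirectSum.lof ℂ ℤ (fun k ↦ formSpace k) (k + 2) ∘ₗ ramanujanLin k

theorem weightOp_single (k : ℤ) (f : formSpace k) :
    weightOp (single k f) = single k (((k : ℂ) / 2) • f) :=
  DirectSum.toModule_lof (R := ℂ) (M := fun k ↦ formSpace k) k f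

theorem ramanujanOp_single (k : ℤ) (f : formSpace k) :
    ramanujanOp (single k f) = single (k + 2) (ramanujanLin k f) :=
  DirectSum.toModule_lof (R := ℂ) (M := fun k ↦ formSpace k) k f

theorem weightOp_apply (f : Forms) (k : ℤ) : weightOp f k = ((k : ℂ) / 2) • f k := by
  induction f using DirectSum.induction_on with
  | zero => simp
  | of i x =>
    rw [weightOp_single]
    by_cases h : i = k
    · subst h; simp [single]
    · rw [single, DirectSum.of_eq_of_ne _ _ _ (Ne.symm h), DirectSum.of_eq_of_ne _ _ _ (Ne.symm h),
        smul_zero]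
  | add f g hf hg => rw [map_add, DirectSum.add_apply, hf, hg, DirectSum.add_apply, smul_add]

theorem ramanujanOp_apply (f : Forms) (k : ℤ) : ramanujanOp f (k + 2) = ramanujanLin k (f k) := by
  induction f using DirectSum.induction_on with
  | zero => simp
  | of i x =>
    rw [ramanujanOp_single]
    by_cases h : i = k
    · subst h; simp [single]
    · rw [single, DirectSum.of_eq_of_ne _ _ _ (by omega), DirectSum.of_eq_of_ne _ _ _ (Ne.symm h),
        map_zero]
  | add f g hf hg => rw [map_add, DirectSum.add_apply, hf, hg, DirectSum.add_apply, map_add]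

theorem weightOp_mul (f g : Forms) : weightOp (f * g) = weightOp f * g + f * weightOp g := by
  induction f using DirectSum.induction_on with
  | zero => simp
  | add f f' hf hf' => simp only [add_mul, map_add, hf, hf']; abel
  | of i x =>
    induction g using DirectSum.induction_on with
    | zero => simp
    | add f f' hf hf' => simp only [mul_add, map_add, hf, hf']; abel
    | of j y =>
      rw [single_mul_single, weightOp_single, weightOp_single, weightOp_single,
        single_mul_single, single_mul_single, ← map_add]
      refine congrArg _ (Subtype.ext (funext fun z ↦ ?_))
      simp only [Submodule.coe_smul, Submodule.coe_add, Pi.add_apply, Pi.smul_apply, Pi.mul_apply,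
        smul_eq_mul]
      push_cast
      ring

theorem ramanujanOp_mul (f g : Forms) :
    ramanujanOp (f * g) = ramanujanOp f * g + f * ramanujanOp g := by
  induction f using DirectSum.induction_on with
  | zero => simp
  | add f f' hf hf' => simp only [add_mul, map_add, hf, hf']; abel
  | of i x =>
    induction g using DirectSum.induction_on with
    | zero => simp
    | add f f' hf hf' => simp only [mul_add, map_add, hf, hf']; abel
    | of j y =>
      rw [single_mul_single, ramanujanOp_single, ramanujanOp_single, ramanujanOp_single,
        single_mul_single, single_mul_single,
        single_congr (show i + 2 + j = i + j + 2 by ring)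
          (g := ⟨_, (show i + 2 + j = i + j + 2 by ring) ▸
            mul_mem_formSpace (ramanujanLin i x).2 y.2⟩) rfl,
        single_congr (show i + (j + 2) = i + j + 2 by ring)
          (g := ⟨_, (show i + (j + 2) = i + j + 2 by ring) ▸
            mul_mem_formSpace x.2 (ramanujanLin j y).2⟩) rfl, ← map_add]
      exact congrArg _ (Subtype.ext
        (ramanujan_mul i j (mdiff_of_mem_formSpace x.2) (mdiff_of_mem_formSpace y.2)))

theorem weightOp_slashHom (α : GQ) (f : Forms) :
    weightOp (slashHom α f) = slashHom α (weightOp f) :=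
  forms_ext fun k ↦ by
    rw [weightOp_apply, slashHom_apply, weightOp_apply, Submodule.coe_smul, Submodule.coe_smul,
      slashHom_apply, slash_smul]

theorem weightOp_ramanujanOp (f : Forms) :
    weightOp (ramanujanOp f) = ramanujanOp f + ramanujanOp (weightOp f) := by
  induction f using DirectSum.induction_on with
  | zero => simp
  | add f f' hf hf' => simp only [map_add, hf, hf']; abel
  | of i x =>
    rw [ramanujanOp_single, weightOp_single, weightOp_single, ramanujanOp_single, map_smul,
      ← map_add]
    refine congrArg _ ?_
    -- The claim becomes an equality of eigenvalues, `(i + 2)/2 = 1 + i/2`.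
    nth_rewrite 2 [← one_smul ℂ (ramanujanLin i x)]
    rw [← add_smul]
    push_cast
    congr 1
    ring

/-- `μ_α` as an element of `M`. -/
def muForm (α : GQ) : Forms := single 2 ⟨mu α, mu_mem_formSpace α⟩

theorem weightOp_muForm (α : GQ) : weightOp (muForm α) = muForm α := by
  rw [muForm, weightOp_single]
  norm_num

theorem muForm_mul (α β : GQ) : muForm (α * β) = slashHom β (muForm α) + muForm β := by
  rw [muForm, muForm, muForm, slashHom_of, ← map_add]
  exact congrArg _ (Subtype.ext (mu_mul α β))

theorem muForm_ofSL (γ : SL(2, ℤ)) : muForm (ofSL γ) = 0 := by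
  rw [muForm, ← map_zero (DirectSum.of (fun k ↦ formSpace k) 2)]
  exact congrArg _ (Subtype.ext (mu_ofSL γ))

theorem muForm_ofSL_mul (γ : SL(2, ℤ)) (α : GQ) : muForm (ofSL γ * α) = muForm α := by
  rw [muForm_mul, muForm_ofSL, map_zero, zero_add]

theorem muForm_mul_ofSL (α : GQ) (γ : SL(2, ℤ)) :
    muForm (α * ofSL γ) = slashHom (ofSL γ) (muForm α) := by
  rw [muForm_mul, muForm_ofSL, add_zero]

theorem ramanujanOp_slashHom (α : GQ) (f : Forms) :
    ramanujanOp (slashHom α f) =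
      slashHom α (ramanujanOp f) + muForm α * weightOp (slashHom α f) := by
  induction f using DirectSum.induction_on with
  | zero => simp
  | add f f' hf hf' => simp only [map_add, mul_add, hf, hf']; abel
  | of i x =>
    rw [slashHom_of, ramanujanOp_single, ramanujanOp_single, slashHom_of, weightOp_single, muForm,
      single_mul_single, single_congr (add_comm 2 i)
        (g := ⟨_, add_comm 2 i ▸ mul_mem_formSpace (mu_mem_formSpace α)
          (((i : ℂ) / 2) • slashLin α i x).2⟩) rfl, ← map_add]
    exact congrArg _ (Subtype.ext (ramanujan_slash i (mdiff_of_mem_formSpace x.2) α))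

theorem ramanujanOp_slashHom_ofSL (γ : SL(2, ℤ)) (f : Forms) :
    ramanujanOp (slashHom (ofSL γ) f) = slashHom (ofSL γ) (ramanujanOp f) := by
  rw [ramanujanOp_slashHom, muForm_ofSL, zero_mul, add_zero]

/-- `Xⁿ(μ_α)` as an element of `M`. -/
def muIterForm (n : ℕ) (α : GQ) : Forms := ramanujanOp^[n] (muForm α)

theorem muIterForm_succ (n : ℕ) (α : GQ) :
    muIterForm (n + 1) α = ramanujanOp (muIterForm n α) :=
  Function.iterate_succ_apply' _ _ _

theorem muIterForm_eq (n : ℕ) (α : GQ) :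
    ∃ h : muIter α n ∈ formSpace (2 * n + 2), muIterForm n α = single (2 * n + 2) ⟨_, h⟩ := by
  induction n with
  | zero => exact ⟨mu_mem_formSpace α, rfl⟩
  | succ n ih =>
    obtain ⟨h, e⟩ := ih
    have hi : (2 * n + 2 + 2 : ℤ) = 2 * (n + 1 : ℕ) + 2 := by push_cast; ring
    refine ⟨hi ▸ ramanujan_mem_formSpace h, ?_⟩
    rw [muIterForm_succ, e, ramanujanOp_single]
    exact single_congr hi rfl

end FormOperators

section HeckeOperators

open UpperHalfPlane hiding I
open Matrix.SpecialLinearGroup CongruenceSubgroup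
open Derivative ModularForm
open scoped MatrixGroups ModularForm DirectSum Manifold

open Cosets

variable {Γ : Subgroup SL(2, ℤ)}

namespace HeckeAlg

/-! ### Operators on the modular Hecke algebra -/

/-- The component of weight `n`, as a function. -/
def component (n : ℤ) : Forms →ₗ[ℂ] (ℍ → ℂ) :=
  (formSpace n).subtype ∘ₗ DirectSum.component ℂ ℤ (fun k ↦ formSpace k) n

theorem component_apply (n : ℤ) (f : Forms) : component n f = (f n : formSpace n) := rfl

theorem eq_zero_of_eq_add_self {f : Forms} (h : f = f + f) : f = 0 :=
  forms_ext fun k ↦ left_eq_add.1 ((congrArg (component k) h).trans (map_add _ _ _))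

theorem mul_apply_term (F G : HeckeAlg Γ) (α : GQ) :
    (F * G) α = ∑ᶠ q : Cosets Γ, term F G α q.out := rfl

/-- The operator `Y` on `A(Γ)`. -/
def weightEnd (Γ : Subgroup SL(2, ℤ)) : Module.End ℂ (HeckeAlg Γ) where
  toFun F := mapLin weightOp weightOp_slashHom F
  map_add' F G := ext fun α ↦ map_add weightOp (F α) (G α)
  map_smul' c F := ext fun α ↦ map_smul weightOp c (F α)

theorem weightEnd_apply (F : HeckeAlg Γ) (α : GQ) : weightEnd Γ F α = weightOp (F α) := rfl

/-- The operator `X` on `A(Γ)`. -/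
def ramanujanEnd (Γ : Subgroup SL(2, ℤ)) : Module.End ℂ (HeckeAlg Γ) where
  toFun F :=
    { toFun := fun α ↦ ramanujanOp (F α)
      left' := fun γ hγ α ↦ by rw [F.left γ hγ]
      right' := fun γ hγ α ↦ by rw [F.right hγ, ramanujanOp_slashHom_ofSL]
      fin' := F.fin.subset fun q hq h ↦ hq (by rw [h, map_zero]) }
  map_add' F G := ext fun α ↦ map_add ramanujanOp (F α) (G α)
  map_smul' c F := ext fun α ↦ map_smul ramanujanOp c (F α)

theorem ramanujanEnd_apply (F : HeckeAlg Γ) (α : GQ) :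
    ramanujanEnd Γ F α = ramanujanOp (F α) := rfl

theorem muIterForm_ofSL_mul (n : ℕ) (γ : SL(2, ℤ)) (α : GQ) :
    muIterForm n (ofSL γ * α) = muIterForm n α := by
  rw [muIterForm, muForm_ofSL_mul, muIterForm]

/-- Needed for `Xⁿ(μ_α) · F_α` to satisfy the right equivariance of `A(Γ)`; it propagates from `μ`
because `X` commutes with integral slash operators. -/
theorem muIterForm_mul_ofSL (n : ℕ) (γ : SL(2, ℤ)) (α : GQ) :
    muIterForm n (α * ofSL γ) = slashHom (ofSL γ) (muIterForm n α) := by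
  induction n with
  | zero => exact muForm_mul_ofSL α γ
  | succ n ih => rw [muIterForm_succ, ih, ramanujanOp_slashHom_ofSL, ← muIterForm_succ]

/-- The multiplication by `Xⁿ(μ_α)` on `A(Γ)`. -/
def muEnd (Γ : Subgroup SL(2, ℤ)) (n : ℕ) : Module.End ℂ (HeckeAlg Γ) where
  toFun F :=
    { toFun := fun α ↦ muIterForm n α * F α
      left' := fun γ hγ α ↦ by rw [F.left γ hγ, muIterForm_ofSL_mul]
      right' := fun γ hγ α ↦ by rw [F.right hγ, muIterForm_mul_ofSL, map_mul]
      fin' := F.fin.subset fun q hq h ↦ hq (by rw [h, mul_zero]) }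
  map_add' F G := ext fun α ↦ mul_add (muIterForm n α) (F α) (G α)
  map_smul' c F := ext fun α ↦ Algebra.mul_smul_comm c (muIterForm n α) (F α)

theorem muEnd_apply (n : ℕ) (F : HeckeAlg Γ) (α : GQ) : muEnd Γ n F α = muIterForm n α * F α := rfl

theorem muEnd_zero_apply (F : HeckeAlg Γ) (α : GQ) : muEnd Γ 0 F α = muForm α * F α := rfl

theorem muEnd_comm (m n : ℕ) : muEnd Γ m * muEnd Γ n = muEnd Γ n * muEnd Γ m :=
  LinearMap.ext fun F ↦ ext fun α ↦ by
    simp only [Module.End.mul_apply, muEnd_apply]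
    exact mul_left_comm _ _ _

theorem ramanujanEnd_muEnd (n : ℕ) :
    ramanujanEnd Γ * muEnd Γ n - muEnd Γ n * ramanujanEnd Γ = muEnd Γ (n + 1) := by
  rw [sub_eq_iff_eq_add]
  refine LinearMap.ext fun F ↦ ext fun α ↦ ?_
  simp only [Module.End.mul_apply, LinearMap.add_apply, add_apply, ramanujanEnd_apply, muEnd_apply,
    ramanujanOp_mul, muIterForm_succ]

theorem weightEnd_muEnd : weightEnd Γ * muEnd Γ 0 - muEnd Γ 0 * weightEnd Γ = muEnd Γ 0 := by
  rw [sub_eq_iff_eq_add]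
  refine LinearMap.ext fun F ↦ ext fun α ↦ ?_
  simp only [Module.End.mul_apply, LinearMap.add_apply, add_apply, weightEnd_apply,
    muEnd_zero_apply, weightOp_mul, weightOp_muForm]

theorem weightEnd_ramanujanEnd :
    weightEnd Γ * ramanujanEnd Γ - ramanujanEnd Γ * weightEnd Γ = ramanujanEnd Γ := by
  rw [sub_eq_iff_eq_add]
  refine LinearMap.ext fun F ↦ ext fun α ↦ ?_
  simp only [Module.End.mul_apply, LinearMap.add_apply, add_apply, weightEnd_apply,
    ramanujanEnd_apply, weightOp_ramanujanOp]

theorem weightEnd_mul (F G : HeckeAlg Γ) :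
    weightEnd Γ (F * G) = weightEnd Γ F * G + F * weightEnd Γ G := by
  refine ext fun α ↦ ?_
  rw [weightEnd_apply, add_apply, mul_apply_term, mul_apply_term, mul_apply_term,
    map_finsum weightOp (term_fin F G α),
    ← finsum_add_distrib (term_fin (weightEnd Γ F) G α) (term_fin F (weightEnd Γ G) α)]
  refine finsum_congr fun q ↦ ?_
  rw [term, weightOp_mul, weightOp_slashHom]
  rfl

/-- Moving `X` past the slash by `β` creates a factor `μ_β`. Attached to `F_β` it is `δ₁(F)`, and
the accompanying `Y` falls on `G`. -/
theorem ramanujanOp_term (F G : HeckeAlg Γ) (α β : GQ) : ramanujanOp (term F G α β) =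
    term (ramanujanEnd Γ F) G α β + term F (ramanujanEnd Γ G) α β +
      term (muEnd Γ 0 F) (weightEnd Γ G) α β := by
  simp only [term, muEnd_zero_apply, ramanujanEnd_apply, weightEnd_apply]
  rw [ramanujanOp_mul, ramanujanOp_slashHom, weightOp_slashHom, mul_add, add_assoc,
    mul_left_comm, mul_assoc]

theorem ramanujanEnd_mul (F G : HeckeAlg Γ) : ramanujanEnd Γ (F * G) =
    ramanujanEnd Γ F * G + F * ramanujanEnd Γ G + muEnd Γ 0 F * weightEnd Γ G := by
  refine ext fun α ↦ ?_
  have h1 := term_fin (ramanujanEnd Γ F) G α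
  have h2 := term_fin F (ramanujanEnd Γ G) α
  have h12 : Function.HasFiniteSupport fun q : Cosets Γ ↦
      term (ramanujanEnd Γ F) G α q.out + term F (ramanujanEnd Γ G) α q.out := h1.add h2
  rw [ramanujanEnd_apply, add_apply, add_apply, mul_apply_term, mul_apply_term, mul_apply_term,
    mul_apply_term, map_finsum ramanujanOp (term_fin F G α), ← finsum_add_distrib h1 h2,
    ← finsum_add_distrib h12 (term_fin (muEnd Γ 0 F) (weightEnd Γ G) α)]
  exact finsum_congr fun q ↦ ramanujanOp_term F G α q.out

theorem muEnd_zero_mul (F G : HeckeAlg Γ) :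
    muEnd Γ 0 (F * G) = muEnd Γ 0 F * G + F * muEnd Γ 0 G := by
  refine ext fun α ↦ ?_
  rw [muEnd_zero_apply, add_apply, mul_apply_term, mul_apply_term, mul_apply_term,
    mul_finsum' _ _ (term_fin F G α),
    ← finsum_add_distrib (term_fin (muEnd Γ 0 F) G α) (term_fin F (muEnd Γ 0 G) α)]
  refine finsum_congr fun q ↦ ?_
  -- The cocycle rule for `α = (αβ⁻¹)β` distributes `μ_α` over the two factors of each summand.
  have h := muForm_mul (α * q.out⁻¹) q.out
  rw [inv_mul_cancel_right] at h
  simp only [term, muEnd_zero_apply, map_mul]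
  rw [h]
  ring

/-! ### Elements supported on the coset `Γ`. -/

theorem ofInvariant_mul_apply {x : Forms} (hx : ∀ γ ∈ Γ, slashHom (ofSL γ) x = x) (F : HeckeAlg Γ)
    (α : GQ) : (ofInvariant Γ x hx * F) α = x * F α := by
  refine ((term_inv (ofInvariant Γ x hx) F α).sum_single 1 fun β hβ ↦ ?_).trans ?_
  · rw [term, ofInvariant_apply_notMem, zero_mul]
    rintro ⟨γ, hγ, h⟩
    exact hβ γ hγ (by rw [mul_one, h])
  · rw [term, ofInvariant_apply_mem (one_mem _), inv_one, mul_one, slashHom_one]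

/-- Here only the coset `Γα` contributes, which introduces the slash by `α`. Multiplication on the
left has none, so commutators with `x` measure `x|α - x`. -/
theorem mul_ofInvariant_apply {x : Forms} (hx : ∀ γ ∈ Γ, slashHom (ofSL γ) x = x) (F : HeckeAlg Γ)
    (α : GQ) : (F * ofInvariant Γ x hx) α = F α * slashHom α x := by
  refine ((term_inv F (ofInvariant Γ x hx) α).sum_single α fun β hβ ↦ ?_).trans ?_
  · rw [term, ofInvariant_apply_notMem, map_zero, mul_zero]
    rintro ⟨γ, hγ, h⟩
    exact hβ γ⁻¹ (Γ.inv_mem hγ) (by rw [map_inv, h]; group)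
  · rw [term, mul_inv_cancel, ofInvariant_apply_mem (one_mem _)]

/-- On the support `Γ` the cocycle `μ` is zero; thus `δ₁` kills `M(Γ)` and the unit. -/
theorem muEnd_zero_ofInvariant {x : Forms} (hx : ∀ γ ∈ Γ, slashHom (ofSL γ) x = x) :
    muEnd Γ 0 (ofInvariant Γ x hx) = 0 := by
  refine ext fun α ↦ ?_
  rw [muEnd_zero_apply, zero_apply]
  by_cases h : α ∈ Γ.map ofSL
  · obtain ⟨γ, -, rfl⟩ := h
    rw [muForm_ofSL, zero_mul]
  · rw [ofInvariant_apply_notMem h, mul_zero]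

theorem ramanujanOp_one : ramanujanOp 1 = 0 := by
  have h := ramanujanOp_mul 1 1
  rw [mul_one, mul_one, one_mul] at h
  exact eq_zero_of_eq_add_self h

theorem weightOp_one : weightOp 1 = 0 := by
  have h := weightOp_mul 1 1
  rw [mul_one, mul_one, one_mul] at h
  exact eq_zero_of_eq_add_self h

theorem ramanujanEnd_one : ramanujanEnd Γ 1 = 0 := by
  refine ext fun α ↦ ?_
  rw [ramanujanEnd_apply, zero_apply]
  by_cases h : α ∈ Γ.map ofSL
  · rw [one_apply_mem h, ramanujanOp_one]
  · rw [one_apply_notMem h, map_zero]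

theorem weightEnd_one : weightEnd Γ 1 = 0 := by
  refine ext fun α ↦ ?_
  rw [weightEnd_apply, zero_apply]
  by_cases h : α ∈ Γ.map ofSL
  · rw [one_apply_mem h, weightOp_one]
  · rw [one_apply_notMem h, map_zero]

/-! ### The representation of `H₁` and the Hopf action. -/

/-- The representation of `H₁` on `A(Γ)`. -/
def actionHom (Γ : Subgroup SL(2, ℤ)) : H1 →ₐ[ℂ] Module.End ℂ (HeckeAlg Γ) :=
  -- The commuting family required by `H1.lift` consists of all multiplications by `Xⁿ(μ)`; `ad X`
  -- shifts it by one step.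
  H1.lift (ramanujanEnd Γ) (weightEnd Γ) (muEnd Γ 0) (Set.range (muEnd Γ))
    (by rintro _ ⟨m, rfl⟩ _ ⟨n, rfl⟩; exact muEnd_comm m n)
    (Algebra.subset_adjoin ⟨0, rfl⟩)
    (by
      rintro _ ⟨n, rfl⟩
      rw [ramanujanEnd_muEnd]
      exact Algebra.subset_adjoin ⟨n + 1, rfl⟩)
    weightEnd_ramanujanEnd weightEnd_muEnd

theorem actionHom_X : actionHom Γ H1.X = ramanujanEnd Γ := H1.lift_X ..

theorem actionHom_Y : actionHom Γ H1.Y = weightEnd Γ := H1.lift_Y ..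

theorem actionHom_δ_one : actionHom Γ (H1.δ 1) = muEnd Γ 0 := H1.lift_δ ..

/-- Indices shift by one since `δ₁` is multiplication by `X⁰(μ)`; the natural subtraction is genuine
because `n ≥ 1`. -/
theorem actionHom_δ (n : ℕ+) : actionHom Γ (H1.δ n) = muEnd Γ (n - 1 : ℕ) := by
  induction n using PNat.recOn with
  | one => exact actionHom_δ_one
  | succ n ih =>
    rw [← H1.xδ, map_sub, map_mul, map_mul, actionHom_X, ih, ramanujanEnd_muEnd]
    congr 1
    have := n.pos
    rw [PNat.add_coe, PNat.one_coe]
    omega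

/-- The Hopf action of `H₁` on `A(Γ)`. -/
def hopfAction (Γ : Subgroup SL(2, ℤ)) : HopfAction H1 (HeckeAlg Γ) :=
  HopfAction.ofGenerators (actionHom Γ)
    (by simp only [actionHom_X, actionHom_Y, actionHom_δ_one]; exact ramanujanEnd_mul)
    (by simp only [actionHom_Y]; exact weightEnd_mul)
    (by simp only [actionHom_δ_one]; exact muEnd_zero_mul)
    (by rw [actionHom_X]; exact ramanujanEnd_one)
    (by rw [actionHom_Y]; exact weightEnd_one)
    (by rw [actionHom_δ_one]; exact muEnd_zero_ofInvariant _)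

theorem hopfAction_act : (hopfAction Γ).act = actionHom Γ := rfl

/-! ### The Schwarzian derivation -/

theorem ofForm_eq (hΓ : IsCongruenceSubgroup Γ) {k : ℤ} (f : ModularForm (Γ.map (mapGL ℝ)) k) :
    ∃ (h : ⇑f ∈ formSpace k) (hx : ∀ γ ∈ Γ, slashHom (ofSL γ) (single k ⟨f, h⟩) = single k ⟨f, h⟩),
      ofForm hΓ f = ofInvariant Γ (single k ⟨f, h⟩) hx :=
  ⟨_, _, rfl⟩

theorem muIterForm_one_add {ω : formSpace 4} (hω : (ω : ℍ → ℂ) = (-1 / 72 : ℂ) • ⇑E₄) (α : GQ) :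
    muIterForm 1 α + single 4 ω =
      slashHom α (single 4 ω) + (1 / 2 : ℂ) • (muForm α * muForm α) := by
  have h1 : muIterForm 1 α = single 4 (ramanujanLin 2 ⟨mu α, mu_mem_formSpace α⟩) := by
    rw [muIterForm_succ]
    exact ramanujanOp_single _ _
  have h2 : (1 / 2 : ℂ) • (muForm α * muForm α) = single 4 ((1 / 2 : ℂ) •
      ⟨mu α * mu α, mul_mem_formSpace (mu_mem_formSpace α) (mu_mem_formSpace α)⟩) := by
    rw [muForm, single_mul_single]
    exact (map_smul (DirectSum.lof ℂ ℤ (fun k ↦ formSpace k) 4) (1 / 2 : ℂ) _).symm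
  rw [h1, h2, slashHom_of, ← map_add, ← map_add]
  refine congrArg _ (Subtype.ext (funext fun z ↦ ?_))
  have h := ramanujan_mu α z
  simp only [Submodule.coe_add, Submodule.coe_smul, Pi.add_apply, Pi.smul_apply, Pi.mul_apply,
    smul_eq_mul]
  change ramanujan 2 (mu α) z + (ω : ℍ → ℂ) z = slash 4 (ω : ℍ → ℂ) α z + _
  rw [hω, slash_smul]
  simp only [Pi.smul_apply, smul_eq_mul]
  linear_combination h

/-- At `α` the commutator is `F_α · (ω₄|α - ω₄)`, and `ramanujan_mu`, lifted to `M` in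
`muIterForm_one_add`, identifies the factor with `X(μ_α) - μ_α²/2`. -/
theorem schwarzian_act (hΓ : IsCongruenceSubgroup Γ) (F : HeckeAlg Γ) :
    (hopfAction Γ).act (H1.δ 2 - (1 / 2 : ℂ) • H1.δ 1 ^ 2) F =
      F * ofForm hΓ (omega4Form Γ) - ofForm hΓ (omega4Form Γ) * F := by
  obtain ⟨h, hx, e⟩ := ofForm_eq hΓ (omega4Form Γ)
  have hδ2 : actionHom Γ (H1.δ 2) = muEnd Γ 1 := actionHom_δ 2
  rw [hopfAction_act, e, map_sub, map_smul, map_pow, hδ2, actionHom_δ_one, LinearMap.sub_apply,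
    LinearMap.smul_apply, sq, Module.End.mul_apply, sub_eq_sub_iff_add_eq_add]
  refine ext fun α ↦ ?_
  rw [add_apply, add_apply, smul_apply, ofInvariant_mul_apply, mul_ofInvariant_apply, muEnd_apply,
    muEnd_zero_apply, muEnd_zero_apply, ← add_mul, muIterForm_one_add rfl, add_mul]
  refine congrArg₂ (· + ·) (mul_comm _ _) ?_
  rw [← mul_assoc]
  exact (Algebra.smul_mul_assoc (1 / 2 : ℂ) (muForm α * muForm α) (F α))

/-! ### The Rankin-Cohen bracket -/

/-- Replacing `D` by `X` adds `-(kl/24) E₂ f g` to both products, so the difference is unchanged.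
Modularity of the bracket follows from that of `X`. -/
theorem rankinCohen_eq (k l : ℤ) (f g : ℍ → ℂ) : rankinCohen k l f g =
    ramanujan k f * (((l : ℂ) / 2) • g) - (((k : ℂ) / 2) • f) * ramanujan l g := by
  ext z
  simp only [rankinCohen, Pi.sub_apply, Pi.mul_apply, Pi.smul_apply, smul_eq_mul, ramanujan_apply]
  ring

theorem rankinCohen_add (k l : ℤ) (f f' : formSpace k) (g : ℍ → ℂ) :
    rankinCohen k l (f + f' : formSpace k) g = rankinCohen k l f g + rankinCohen k l f' g := by
  rw [rankinCohen_eq, rankinCohen_eq, rankinCohen_eq, Submodule.coe_add,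
    ramanujan_add k (mdiff_of_mem_formSpace f.2) (mdiff_of_mem_formSpace f'.2), smul_add]
  ring

theorem rankinCohen_zero (k l : ℤ) (g : ℍ → ℂ) : rankinCohen k l (0 : formSpace k) g = 0 := by
  have h := rankinCohen_add k l 0 0 g
  rw [add_zero] at h
  exact left_eq_add.1 h

theorem rankinCohen_support (f : Forms) (g : ℤ → ℍ → ℂ) (l : ℤ → ℤ) :
    Function.HasFiniteSupport fun k ↦ rankinCohen k (l k) (f k : formSpace k) (g k) := by
  refine (DFinsupp.finite_support f).subset fun k hk h ↦ hk ?_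
  beta_reduce
  rw [h, rankinCohen_zero]

/-- The bracket raises the total weight by `2`, so weight `k` in `f` meets weight `n - 2 - k` in
`g`. By linearity `f` may be homogeneous, and then a single `k` contributes. -/
theorem component_bracket (f g : Forms) (n : ℤ) :
    component n (ramanujanOp f * weightOp g) = component n (weightOp f * ramanujanOp g) +
      ∑ᶠ k : ℤ, rankinCohen k (n - 2 - k) (f k : formSpace k)
        (g (n - 2 - k) : formSpace (n - 2 - k)) := by
  induction f using DirectSum.induction_on with
  | zero => simp only [map_zero, zero_mul, DirectSum.zero_apply, rankinCohen_zero, finsum_zero,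
      add_zero]
  | add f f' hf hf' =>
    simp only [map_add, add_mul, hf, hf', DirectSum.add_apply, rankinCohen_add]
    rw [finsum_add_distrib (rankinCohen_support f _ _) (rankinCohen_support f' _ _)]
    abel
  | of i x =>
    rw [finsum_eq_single _ i fun k hk ↦ by
      rw [DirectSum.of_eq_of_ne _ _ _ hk, rankinCohen_zero], DirectSum.of_eq_same,
      rankinCohen_eq, ramanujanOp_single, weightOp_single, component_apply, component_apply,
      single_mul_apply (show i + 2 + (n - 2 - i) = n by ring),
      single_mul_apply (show i + (n - 2 - i + 2) = n by ring), weightOp_apply, ramanujanOp_apply]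
    exact (add_sub_cancel _ _).symm

theorem chi_fundamental_add (a b : HeckeAlg Γ) : (hopfAction Γ).chi H1.fundamental a b +
    (weightEnd Γ a * ramanujanEnd Γ b + muEnd Γ 0 (weightEnd Γ a) * weightEnd Γ b) =
      ramanujanEnd Γ a * weightEnd Γ b := by
  rw [HopfAction.chi_fundamental, hopfAction_act, actionHom_X, actionHom_Y, actionHom_δ_one]
  abel

theorem component_mul_apply (a b : HeckeAlg Γ) (α : GQ) (n : ℤ) :
    component n ((a * b) α) = ∑ᶠ q : Cosets Γ, component n (term a b α q.out) :=
  map_finsum (component n) (term_fin a b α)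

theorem component_term_fin (a : HeckeAlg Γ) (b : GQ → Forms) (α : GQ) (n : ℤ) :
    Function.HasFiniteSupport fun q : Cosets Γ ↦ component n (term a b α q.out) :=
  (term_fin a b α).subset fun q hq h ↦ hq (by
    beta_reduce at h ⊢
    rw [h, map_zero])

/-- In each summand the terms of `Y ⊗ X` and `δ₁Y ⊗ Y` combine: `X(b)|β + μ_β · Y(b|β) = X(b|β)`.
All occurrences of `μ` are absorbed, and the bracket of `a_β` with `b_{αβ⁻¹}|β` remains. -/
theorem chi_fundamental_apply (a b : HeckeAlg Γ) (α : GQ) (n : ℤ) :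
    (((hopfAction Γ).chi H1.fundamental a b α n : formSpace n) : ℍ → ℂ) =
      ∑ᶠ (q : Cosets Γ) (k : ℤ), rankinCohen k (n - 2 - k) (a q.out k : formSpace k)
        (slashHom q.out (b (α * q.out⁻¹)) (n - 2 - k) : formSpace (n - 2 - k)) := by
  have h := congrArg (fun F : HeckeAlg Γ ↦ component n (F α)) (chi_fundamental_add a b)
  simp only [add_apply, map_add, component_mul_apply] at h
  have h1 := component_term_fin (weightEnd Γ a) (ramanujanEnd Γ b) α n
  have h2 := component_term_fin (muEnd Γ 0 (weightEnd Γ a)) (weightEnd Γ b) α n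
  have h3 := component_term_fin (ramanujanEnd Γ a) (weightEnd Γ b) α n
  have h12 : Function.HasFiniteSupport fun q : Cosets Γ ↦
      component n (term (weightEnd Γ a) (ramanujanEnd Γ b) α q.out) +
        component n (term (muEnd Γ 0 (weightEnd Γ a)) (weightEnd Γ b) α q.out) := h1.add h2
  rw [← finsum_add_distrib h1 h2, ← eq_sub_iff_add_eq, ← finsum_sub_distrib h3 h12] at h
  refine h.trans (finsum_congr fun q ↦ ?_)
  rw [sub_eq_iff_eq_add', ← map_add]
  simp only [term, muEnd_zero_apply, ramanujanEnd_apply, weightEnd_apply]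
  rw [← weightOp_slashHom, component_bracket, ramanujanOp_slashHom, mul_add, mul_left_comm,
    mul_assoc]

/-! ### Modularity of the bracket and its value on `M(Γ)`. -/

theorem rankinCohen_slash_ofSL (k l : ℤ) {f g : ℍ → ℂ} (hf : MDiff f) (hg : MDiff g)
    (γ : SL(2, ℤ)) : slash (k + l + 2) (rankinCohen k l f g) (ofSL γ) =
      rankinCohen k l (slash k f (ofSL γ)) (slash l g (ofSL γ)) := by
  rw [rankinCohen_eq, rankinCohen_eq, sub_eq_add_neg, ← neg_one_smul ℂ, slash_add, slash_smul,
    ← ramanujan_slash_ofSL k hf, ← ramanujan_slash_ofSL l hg, ← slash_smul l,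
    ← slash_smul k, ← slash_mul, ← slash_mul, neg_one_smul, ← sub_eq_add_neg,
    show k + 2 + l = k + l + 2 by ring, show k + (l + 2) = k + l + 2 by ring]

theorem mdiff_rankinCohen (k l : ℤ) {f g : ℍ → ℂ} (hf : MDiff f) (hg : MDiff g) :
    MDiff (rankinCohen k l f g) := by
  rw [rankinCohen_eq]
  exact ((mdiff_ramanujan k hf).mul (hg.const_smul _)).sub
    ((hf.const_smul _).mul (mdiff_ramanujan l hg))

theorem isBoundedAtImInfty_rankinCohen (k l : ℤ) {f g : ℍ → ℂ} (hf : MDiff f) (hg : MDiff g)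
    (hf' : IsBoundedAtImInfty f) (hg' : IsBoundedAtImInfty g) :
    IsBoundedAtImInfty (rankinCohen k l f g) := by
  rw [rankinCohen_eq, sub_eq_add_neg]
  exact ((isBoundedAtImInfty_ramanujan k hf hf').mul (Filter.BoundedAtFilter.smul _ hg')).add
    (((Filter.BoundedAtFilter.smul _ hf').mul (isBoundedAtImInfty_ramanujan l hg hg')).neg)

/-- The first Rankin-Cohen bracket of modular forms. -/
def rankinCohenForm [Γ.FiniteIndex] {k l : ℤ} (f : ModularForm (Γ.map (mapGL ℝ)) k)
    (g : ModularForm (Γ.map (mapGL ℝ)) l) : ModularForm (Γ.map (mapGL ℝ)) (k + l + 2) :=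
  have hf := ModularFormClass.holo f
  have hg := ModularFormClass.holo g
  mkModularForm (rankinCohen k l f g) (mdiff_rankinCohen k l hf hg)
    (fun γ hγ ↦ by
      rw [rankinCohen_slash_ofSL k l hf hg, slash_eq_self_of_mem f hγ, slash_eq_self_of_mem g hγ])
    (fun γ ↦ by
      rw [rankinCohen_slash_ofSL k l hf hg]
      exact isBoundedAtImInfty_rankinCohen k l (mdiff_slash k hf _) (mdiff_slash l hg _)
        (isBoundedAtImInfty_slash f γ) (isBoundedAtImInfty_slash g γ))

theorem weightEnd_ofInvariant {x : Forms} (hx : ∀ γ ∈ Γ, slashHom (ofSL γ) x = x) :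
    weightEnd Γ (ofInvariant Γ x hx) = ofInvariant Γ (weightOp x)
      fun γ hγ ↦ by rw [← weightOp_slashHom, hx γ hγ] := by
  refine ext fun α ↦ ?_
  rw [weightEnd_apply]
  by_cases h : α ∈ Γ.map ofSL
  · rw [ofInvariant_apply_mem h, ofInvariant_apply_mem h]
  · rw [ofInvariant_apply_notMem h, ofInvariant_apply_notMem h, map_zero]

theorem ramanujanEnd_ofInvariant {x : Forms} (hx : ∀ γ ∈ Γ, slashHom (ofSL γ) x = x) :
    ramanujanEnd Γ (ofInvariant Γ x hx) = ofInvariant Γ (ramanujanOp x)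
      fun γ hγ ↦ by rw [← ramanujanOp_slashHom_ofSL, hx γ hγ] := by
  refine ext fun α ↦ ?_
  rw [ramanujanEnd_apply]
  by_cases h : α ∈ Γ.map ofSL
  · rw [ofInvariant_apply_mem h, ofInvariant_apply_mem h]
  · rw [ofInvariant_apply_notMem h, ofInvariant_apply_notMem h, map_zero]

theorem single_rankinCohen {k l : ℤ} (f : formSpace k) (g : formSpace l)
    {h : formSpace (k + l + 2)} (hh : (h : ℍ → ℂ) = rankinCohen k l f g) :
    single (k + l + 2) h + weightOp (single k f) * ramanujanOp (single l g) =
      ramanujanOp (single k f) * weightOp (single l g) := by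
  rw [weightOp_single, weightOp_single, ramanujanOp_single, ramanujanOp_single,
    single_mul_single, single_mul_single,
    single_congr (show k + 2 + l = k + l + 2 by ring)
      (g := ⟨_, (show k + 2 + l = k + l + 2 by ring) ▸
        mul_mem_formSpace (ramanujanLin k f).2 (((l : ℂ) / 2) • g).2⟩) rfl,
    single_congr (show k + (l + 2) = k + l + 2 by ring)
      (g := ⟨_, (show k + (l + 2) = k + l + 2 by ring) ▸
        mul_mem_formSpace (((k : ℂ) / 2) • f).2 (ramanujanLin l g).2⟩) rfl, ← map_add]
  refine congrArg _ (Subtype.ext ?_)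
  rw [Submodule.coe_add, hh, rankinCohen_eq]
  exact sub_add_cancel _ _

theorem chi_fundamental_ofForm (hΓ : IsCongruenceSubgroup Γ) (k l : ℤ)
    (f : ModularForm (Γ.map (mapGL ℝ)) k) (g : ModularForm (Γ.map (mapGL ℝ)) l) :
    ∃ h : ModularForm (Γ.map (mapGL ℝ)) (k + l + 2), ⇑h = rankinCohen k l f g ∧
      (hopfAction Γ).chi H1.fundamental (ofForm hΓ f) (ofForm hΓ g) = ofForm hΓ h := by
  have := hΓ.finiteIndex
  refine ⟨rankinCohenForm f g, rfl, ?_⟩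
  have h := chi_fundamental_add (ofForm hΓ f) (ofForm hΓ g)
  obtain ⟨mf, hf, ef⟩ := ofForm_eq hΓ f
  obtain ⟨mg, hg, eg⟩ := ofForm_eq hΓ g
  obtain ⟨mh, hh, eh⟩ := ofForm_eq hΓ (rankinCohenForm f g)
  rw [ef, eg] at h ⊢
  rw [weightEnd_ofInvariant, weightEnd_ofInvariant, ramanujanEnd_ofInvariant,
    ramanujanEnd_ofInvariant, muEnd_zero_ofInvariant, zero_mul, add_zero] at h
  rw [eh]
  refine add_right_cancel (h.trans (ext fun α ↦ ?_))
  rw [add_apply, ofInvariant_mul_apply, ofInvariant_mul_apply]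
  by_cases hα : α ∈ Γ.map ofSL
  · rw [ofInvariant_apply_mem hα, ofInvariant_apply_mem hα, ofInvariant_apply_mem hα]
    exact (single_rankinCohen ⟨f, mf⟩ ⟨g, mg⟩ rfl).symm
  · rw [ofInvariant_apply_notMem hα, ofInvariant_apply_notMem hα, ofInvariant_apply_notMem hα,
      mul_zero, mul_zero, add_zero]

/-! ### Invariance of the cuspidal ideal -/

/-- Stability under generators suffices. `Y` rescales components, `δ₁` multiplies by a modular form,
and `X` preserves vanishing at the cusps. -/
theorem act_mem_cuspidalIdeal (h : H1) {F : HeckeAlg Γ} (hF : F ∈ cuspidalIdeal Γ) :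
    (hopfAction Γ).act h F ∈ cuspidalIdeal Γ := by
  rw [hopfAction_act]
  induction h using H1.induction generalizing F with
  | hc c =>
    rw [mem_cuspidalIdeal] at hF ⊢
    intro α k
    rw [AlgHom.commutes, Module.algebraMap_end_apply, smul_apply]
    exact (cuspSpace k).smul_mem c (hF α k)
  | hX =>
    rw [mem_cuspidalIdeal] at hF ⊢
    intro α k
    obtain ⟨j, rfl⟩ : ∃ j, k = j + 2 := ⟨k - 2, by ring⟩
    rw [actionHom_X, ramanujanEnd_apply, ramanujanOp_apply]
    exact ramanujan_mem_cuspSpace (hF α j)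
  | hY =>
    rw [mem_cuspidalIdeal] at hF ⊢
    intro α k
    rw [actionHom_Y, weightEnd_apply, weightOp_apply]
    exact (cuspSpace k).smul_mem _ (hF α k)
  | hδ =>
    rw [mem_cuspidalIdeal] at hF ⊢
    intro α
    rw [actionHom_δ_one, muEnd_zero_apply]
    exact IsCuspidal.mul' _ (hF α)
  | hadd h k hh hk =>
    rw [map_add]
    exact add_mem (hh hF) (hk hF)
  | hmul h k hh hk =>
    rw [map_mul]
    exact hh (hk hF)

end HeckeAlg

end HeckeOperators

end ConnesMoscovici
end

/-! ### The theorem. -/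

open ConnesMoscovici HeckeAlg in
open scoped MatrixGroups in
theorem mainTheorem3 (Γ : Subgroup SL(2, ℤ)) (hΓ : CongruenceSubgroup.IsCongruenceSubgroup Γ) :
    ∃ ρ : HopfAction H1 (HeckeAlg Γ),
      -- the formulas for the action of the generators, in each weight
      (∀ (F : HeckeAlg Γ) (α : GQ) (k : ℤ),
        (((ρ.act H1.Y F) α k : formSpace k) : UpperHalfPlane → ℂ) =
          ((k : ℂ) / 2) • ((F α k : formSpace k) : UpperHalfPlane → ℂ) ∧
        (((ρ.act H1.X F) α (k + 2) : formSpace (k + 2)) : UpperHalfPlane → ℂ) =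
          ramanujan k (F α k : formSpace k) ∧
        ∀ n : ℕ+, (((ρ.act (H1.δ n) F) α (k + 2 * n) : formSpace (k + 2 * n)) :
            UpperHalfPlane → ℂ) =
          muIter α (n - 1 : ℕ) * ((F α k : formSpace k) : UpperHalfPlane → ℂ)) ∧
      -- the Schwarzian is inner, implemented by `ω₄`
      (∀ a : HeckeAlg Γ, ρ.act (H1.δ 2 - (1 / 2 : ℂ) • H1.δ 1 ^ 2) a =
        a * ofForm hΓ (omega4Form Γ) - ofForm hΓ (omega4Form Γ) * a) ∧
      (∀ Z : ℂ → ℂ,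
        (∀ z : ℂ, 0 < z.im →
          HasDerivAt Z (2 * Real.pi * Complex.I / 6 * ModularForm.eta z ^ 4) z) →
        ∀ z : UpperHalfPlane,
          omega4Form Γ z = ((2 * Real.pi * Complex.I) ^ 2)⁻¹ * schwarzian Z z) ∧
      -- the image of the transverse fundamental class
      (∃ (hF : (H1.fundamental, (0 : ℂ)) ∈ HopfCyclicZ2 H1.ν)
          (hχ : ρ.chi H1.fundamental ∈ HochZ2 (HeckeAlg Γ)),
        ρ.charMap H1.ν (Submodule.Quotient.mk ⟨(H1.fundamental, 0), hF⟩) =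
          HochHH2.mk (HeckeAlg Γ) ⟨ρ.chi H1.fundamental, hχ⟩) ∧
      (∀ a b : HeckeAlg Γ, ρ.chi H1.fundamental a b =
        ρ.act H1.X a * ρ.act H1.Y b - ρ.act H1.Y a * ρ.act H1.X b
          - ρ.act (H1.δ 1) (ρ.act H1.Y a) * ρ.act H1.Y b) ∧
      (∀ (k l : ℤ) (f : ModularForm (Γ.map (Matrix.SpecialLinearGroup.mapGL ℝ)) k)
          (g : ModularForm (Γ.map (Matrix.SpecialLinearGroup.mapGL ℝ)) l),
        ∃ h : ModularForm (Γ.map (Matrix.SpecialLinearGroup.mapGL ℝ)) (k + l + 2),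
          ⇑h = rankinCohen k l f g ∧
          ρ.chi H1.fundamental (ofForm hΓ f) (ofForm hΓ g) = ofForm hΓ h) ∧
      (∀ (a b : HeckeAlg Γ) (α : GQ) (n : ℤ),
        (((ρ.chi H1.fundamental a b) α n : formSpace n) : UpperHalfPlane → ℂ) =
          ∑ᶠ (q : Cosets Γ) (k : ℤ), rankinCohen k (n - 2 - k) (a q.out k : formSpace k)
            (slashHom q.out (b (α * q.out⁻¹)) (n - 2 - k) : formSpace (n - 2 - k))) ∧
      -- invariance of the cuspidal ideal
      (∀ (h : H1) (F : HeckeAlg Γ), F ∈ cuspidalIdeal Γ → ρ.act h F ∈ cuspidalIdeal Γ) := by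
  refine ⟨hopfAction Γ, fun F α k ↦ ⟨?_, ?_, fun n ↦ ?_⟩, schwarzian_act hΓ, fun Z hZ z ↦ ?_,
    -- The map on cohomology is induced by `χ` on representatives, so the equality of classes is
    -- definitional.
    ⟨fundamental_mem_HopfCyclicZ2, (hopfAction Γ).chi_mem hopfB2_fundamental, rfl⟩,
    (hopfAction Γ).chi_fundamental, chi_fundamental_ofForm hΓ, chi_fundamental_apply,
    fun h F hF ↦ act_mem_cuspidalIdeal h hF⟩
  · rw [hopfAction_act, actionHom_Y, weightEnd_apply, weightOp_apply]
    rfl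
  · rw [hopfAction_act, actionHom_X, ramanujanEnd_apply, ramanujanOp_apply]
    rfl
  · obtain ⟨h, e⟩ := muIterForm_eq (n - 1 : ℕ) α
    -- Positivity of `n` turns the weight `2(n - 1) + 2` of `Xⁿ⁻¹(μ_α)`, with natural subtraction,
    -- into `2n`.
    have hn := n.pos
    rw [hopfAction_act, actionHom_δ, muEnd_apply, e, single_mul_apply (j := k) (by omega)]
  · have h2pi : (2 * Real.pi * Complex.I : ℂ) ≠ 0 := by
      simp [Real.pi_ne_zero]
    rw [schwarzian_eq hZ, inv_mul_cancel_left₀ (pow_ne_zero 2 h2pi)]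
    rfl
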